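/- Let $(X,g)$ be a closed (compact, without boundary) smooth Riemannian manifold with volume measure $dv_g$, and let $E,F$ be smooth real vector bundles of finite rank over $X$ with smooth fibre metrics. Let $D:\Gamma(E)\to\Gamma(F)$ be a first order elliptic differential operator on smooth sections, with symbol $\sigma:T^*X\to\mathrm{Hom}(E,F)$ defined by $D(f\xi)=\sigma(df)\xi+fD\xi$ for all $f\in C^\infty(X)$, $\xi\in\Gamma(E)$; ellipticity means that $\sigma(u)$ is an isomorphism for every covector $u\neq 0$. Let $\mathcal A:E\to F$ be a smooth real bundle map, and put $D_s=D+s\mathcal A$ for $s\in\mathbb R$. Suppose that $(\sigma,\mathcal A)$ is a concentrating pair, i.e. $\mathcal A^*\circ\sigma(u)=\sigma(u)^*\circ\mathcal A$ for every $u\in T^*X$. Let $Z_{\mathcal A}=\{x\in X : \ker\mathcal A(x)\neq 0\}$ be the singular set of $\mathcal A$ and, for $\delta>0$, let $\Omega(\delta)=X\setminus Z(\delta)$, where $Z(\delta)$ is the open $\delta$-neighbourhood of $Z_{\mathcal A}$ for the Riemannian distance. Write $\|\cdot\|_2$ for the $L^2$ norms of sections. Then for every $\delta>0$ and $C\ge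 0$ there is a constant $C'>0$ (depending on $\delta$, $C$ and the data $X,g,E,F,D,\mathcal A$, but not on $s$ or $\xi$) such that for every real $s\neq 0$ and every $\xi\in C^\infty(E)$ with $\|\xi\|_2=1$ and $\|D_s\xi\|_2^2\le C|s|$, $$\int_{\Omega(\delta)}|\xi|^2\,dv_g<\frac{C'}{|s|}.$$ -/

import Mathlib

open Bundle Manifold MeasureTheory
open scoped ContDiff ENNReal

noncomputable section

namespace Concentration

/-! ### The Riemannian volume measure -/

section Volume

variable {n : ℕ} {X : Type*} [TopologicalSpace X] [ChartedSpace (EuclideanSpace ℝ (Fin n)) X]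
  [RiemannianBundle (fun x : X ↦ TangentSpace (𝓡 n) x)]

/-- The coordinate vector field `∂ᵢ` of the preferred chart at `x₀`, at the point with
coordinates `y`. -/
def coordVector (x₀ : X) (y : EuclideanSpace ℝ (Fin n)) (i : Fin n) :
    TangentSpace (𝓡 n) ((extChartAt (𝓡 n) x₀).symm y) :=
  mfderiv 𝓘(ℝ, EuclideanSpace ℝ (Fin n)) (𝓡 n) (extChartAt (𝓡 n) x₀).symm y
    (EuclideanSpace.single i (1 : ℝ))

/-- The Riemannian density `√(det (gᵢⱼ))` in the preferred chart at `x₀`. -/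
def volumeDensity (x₀ : X) (y : EuclideanSpace ℝ (Fin n)) : ℝ :=
  √((Matrix.of fun i j : Fin n ↦ inner ℝ (coordVector x₀ y i) (coordVector x₀ y j)).det)

variable [MeasurableSpace X]

/-- The measure `√(det (gᵢⱼ)) dy¹ ⋯ dyⁿ` on the domain of the preferred chart at `x₀`,
regarded as a measure on `X`. -/
def chartVolume (x₀ : X) : Measure X :=
  ((volume.restrict (extChartAt (𝓡 n) x₀).target).withDensity
    fun y ↦ ENNReal.ofReal (volumeDensity x₀ y)).map (extChartAt (𝓡 n) x₀).symm

variable (n X) in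
/-- The Riemannian volume measure `dv_g`. By the change of variables formula the chart measures
agree on overlaps, so their supremum in the lattice of measures is the measure which restricts
to `chartVolume x₀` on the domain of each chart. -/
def riemannianVolume : Measure X := ⨆ x₀ : X, chartVolume (n := n) x₀

end Volume

/-! ### Operators between sections of vector bundles -/

section Operators

variable {n : ℕ} {X : Type*} [TopologicalSpace X] [ChartedSpace (EuclideanSpace ℝ (Fin n)) X]
  [IsManifold (𝓡 n) ∞ X]
  {VE : Type*} [NormedAddCommGroup VE] [NormedSpace ℝ VE]
  {E : X → Type*} [TopologicalSpace (TotalSpace VE E)] [∀ x, NormedAddCommGroup (E x)]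
  [∀ x, InnerProductSpace ℝ (E x)] [FiberBundle VE E] [VectorBundle ℝ VE E]
  {VF : Type*} [NormedAddCommGroup VF] [NormedSpace ℝ VF]
  {F : X → Type*} [TopologicalSpace (TotalSpace VF F)] [∀ x, NormedAddCommGroup (F x)]
  [∀ x, InnerProductSpace ℝ (F x)] [FiberBundle VF F] [VectorBundle ℝ VF F]

/-- The product `f ξ` of a smooth function and a smooth section. -/
def smulSection (f : C^∞⟮𝓡 n, X; ℝ⟯) (ξ : Cₛ^∞⟮𝓡 n; VE, E⟯) : Cₛ^∞⟮𝓡 n; VE, E⟯ :=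
  ⟨fun x ↦ f x • ξ x, f.contMDiff.smul_section ξ.contMDiff⟩

/-- `σ` is the symbol of the first order differential operator `D`:
`D (f ξ) = σ(df) ξ + f D ξ` for all smooth functions `f` and smooth sections `ξ`.
A linear operator between spaces of smooth sections is a differential operator of order at most one
exactly if it has a symbol in this sense, and the symbol is then unique. -/
def HasSymbol (D : Cₛ^∞⟮𝓡 n; VE, E⟯ →ₗ[ℝ] Cₛ^∞⟮𝓡 n; VF, F⟯)
    (σ : ∀ x : X, (TangentSpace (𝓡 n) x →L[ℝ] ℝ) →ₗ[ℝ] (E x →L[ℝ] F x)) : Prop :=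
  ∀ (f : C^∞⟮𝓡 n, X; ℝ⟯) (ξ : Cₛ^∞⟮𝓡 n; VE, E⟯) (x : X),
    D (smulSection f ξ) x = σ x (mvfderiv (𝓡 n) f x) (ξ x) + f x • D ξ x

/-- Ellipticity: the symbol of every nonzero covector is an isomorphism. -/
def IsElliptic (σ : ∀ x : X, (TangentSpace (𝓡 n) x →L[ℝ] ℝ) →ₗ[ℝ] (E x →L[ℝ] F x)) : Prop :=
  ∀ (x : X) (u : TangentSpace (𝓡 n) x →L[ℝ] ℝ), u ≠ 0 → Function.Bijective (σ x u)

variable (VE) in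
theorem completeSpace_fiber [FiniteDimensional ℝ VE] (x : X) : CompleteSpace (E x) :=
  have : FiniteDimensional ℝ (E x) := FiniteDimensional.of_injective
    ((trivializationAt VE E x).continuousLinearEquivAt ℝ x
      (mem_baseSet_trivializationAt VE E x)).toLinearEquiv.toLinearMap
    ((trivializationAt VE E x).continuousLinearEquivAt ℝ x
      (mem_baseSet_trivializationAt VE E x)).injective
  FiniteDimensional.complete ℝ (E x)

/-- `(σ, A)` is a concentrating pair: `A* ∘ σ(u) = σ(u)* ∘ A` for every covector `u`, with
adjoints taken with respect to the metrics on the fibers of `E` and `F`. -/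
def IsConcentratingPair [FiniteDimensional ℝ VE] [FiniteDimensional ℝ VF]
    (σ : ∀ x : X, (TangentSpace (𝓡 n) x →L[ℝ] ℝ) →ₗ[ℝ] (E x →L[ℝ] F x))
    (A : Cₛ^∞⟮𝓡 n; VE →L[ℝ] VF, fun x ↦ E x →L[ℝ] F x⟯) : Prop :=
  ∀ (x : X) (u : TangentSpace (𝓡 n) x →L[ℝ] ℝ),
    haveI := completeSpace_fiber VE (E := E) x
    haveI := completeSpace_fiber VF (E := F) x
    (A x).adjoint ∘L σ x u = (σ x u).adjoint ∘L A x

/-- The operator on smooth sections given by a smooth bundle map `A : E → F`. -/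
def bundleMapOp (A : Cₛ^∞⟮𝓡 n; VE →L[ℝ] VF, fun x ↦ E x →L[ℝ] F x⟯) :
    Cₛ^∞⟮𝓡 n; VE, E⟯ →ₗ[ℝ] Cₛ^∞⟮𝓡 n; VF, F⟯ where
  toFun ξ := ⟨fun x ↦ A x (ξ x), A.contMDiff.clm_bundle_apply ξ.contMDiff⟩
  map_add' ξ η := by ext x; exact (A x).map_add (ξ x) (η x)
  map_smul' c ξ := by ext x; exact (A x).map_smul c (ξ x)

/-- The family `D_s = D + s A`. -/
def perturbedOp (D : Cₛ^∞⟮𝓡 n; VE, E⟯ →ₗ[ℝ] Cₛ^∞⟮𝓡 n; VF, F⟯)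
    (A : Cₛ^∞⟮𝓡 n; VE →L[ℝ] VF, fun x ↦ E x →L[ℝ] F x⟯) (s : ℝ) :
    Cₛ^∞⟮𝓡 n; VE, E⟯ →ₗ[ℝ] Cₛ^∞⟮𝓡 n; VF, F⟯ :=
  D + s • bundleMapOp A

/-- The singular set `Z_A` of points at which `A` has nonzero kernel. -/
def singularSet (A : Cₛ^∞⟮𝓡 n; VE →L[ℝ] VF, fun x ↦ E x →L[ℝ] F x⟯) : Set X :=
  {x | LinearMap.ker (A x).toLinearMap ≠ ⊥}

/-- The `L²` norm of a smooth section. -/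
def l2Norm [RiemannianBundle (fun x : X ↦ TangentSpace (𝓡 n) x)] [MeasurableSpace X]
    (ξ : Cₛ^∞⟮𝓡 n; VE, E⟯) : ℝ :=
  √(∫ x, ‖ξ x‖ ^ 2 ∂(riemannianVolume n X))

end Operators

end Concentration

end

/-! Expanding the square gives `‖D_s ξ‖² = ‖Dξ‖² + 2s⟨Dξ, Aξ⟩ + s²‖Aξ‖²` in `L²`. If the cross term
is bounded by `C₁‖ξ‖²`, then for `‖ξ‖ = 1` the hypothesis yields `s²‖Aξ‖² ≤ (C + 2C₁)|s|`, that is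
`‖Aξ‖² ≤ (C + 2C₁)/|s|`. On the compact set `Ω(δ)` the map `A` is injective, hence satisfies `κ|ξ| ≤
|Aξ|` for some `κ > 0` (`exists_mul_norm_le_of_ker_eq_bot`), and the claim follows.

The point is the cross term (`exists_abs_integral_inner_le`), which a priori contains a derivative
of `ξ`. Write `ξ = ∑ f_a e_a` with finitely many fixed smooth sections `e_a` and `|f_a| ≤ B|ξ|`
(`exists_generating_sections`). The derivatives enter through `∑ f_b L_ab(df_a)`, where `L_ab(u) =
⟨σ(u)e_a, A e_b⟩`. The concentrating condition says exactly that `L_ab = L_ba`, so this sum is `½ ∑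
L_ab(d(f_a f_b))`: derivatives of functions along fixed smooth vector fields. Integration by parts
in charts (`exists_abs_integral_derivation_le`) bounds its integral by a multiple of `∑ ∫ |f_a
f_b|`, hence of `∫ |ξ|²`. -/

noncomputable section

namespace Concentration

/-! ### Derivatives of charts and transition maps -/

section Charts

open Set Filter Topology

variable {V : Type*} [NormedAddCommGroup V] [NormedSpace ℝ V]
  {M : Type*} [TopologicalSpace M] [ChartedSpace V M] [IsManifold 𝓘(ℝ, V) ∞ M]

lemma mfderiv_extChartAt_symm_injective (x₀ : M) {y : V}
    (hy : y ∈ (extChartAt 𝓘(ℝ, V) x₀).target) :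
    Function.Injective (mfderiv 𝓘(ℝ, V) 𝓘(ℝ, V) (extChartAt 𝓘(ℝ, V) x₀).symm y) := by
  have h := isInvertible_mfderivWithin_extChartAt_symm (I := 𝓘(ℝ, V)) hy
  simp only [modelWithCornersSelf_coe, range_id, mfderivWithin_univ] at h
  exact h.injective

lemma mdifferentiableAt_extChartAt_symm (x₀ : M) {y : V}
    (hy : y ∈ (extChartAt 𝓘(ℝ, V) x₀).target) :
    MDifferentiableAt 𝓘(ℝ, V) 𝓘(ℝ, V) (extChartAt 𝓘(ℝ, V) x₀).symm y :=
  ((contMDiffOn_extChartAt_symm (I := 𝓘(ℝ, V)) (n := ∞) x₀).contMDiffAt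
    ((isOpen_extChartAt_target x₀).mem_nhds hy)).mdifferentiableAt (by simp)

lemma contMDiffOn_mfderiv_extChartAt_symm (x₀ : M) (v : V) :
    ContMDiffOn 𝓘(ℝ, V) 𝓘(ℝ, V).tangent ∞
      (fun y ↦ (⟨(extChartAt 𝓘(ℝ, V) x₀).symm y,
        mfderiv 𝓘(ℝ, V) 𝓘(ℝ, V) (extChartAt 𝓘(ℝ, V) x₀).symm y v⟩ : TangentBundle 𝓘(ℝ, V) M))
      (extChartAt 𝓘(ℝ, V) x₀).target := by
  have hopen : IsOpen (extChartAt 𝓘(ℝ, V) x₀).target := isOpen_extChartAt_target x₀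
  have h1 := (contMDiffOn_extChartAt_symm (I := 𝓘(ℝ, V)) (n := ∞) x₀).contMDiffOn_tangentMapWithin
    (m := ∞) (by simp) hopen.uniqueMDiffOn
  have h2 : ContMDiff 𝓘(ℝ, V) 𝓘(ℝ, V).tangent ∞ (fun y ↦ (⟨y, v⟩ : TangentBundle 𝓘(ℝ, V) V)) :=
    contMDiff_vectorSpace_iff_contDiff.2 contDiff_const
  refine (h1.comp h2.contMDiffOn (fun y hy ↦ hy)).congr fun y hy ↦ ?_
  simp only [Function.comp, tangentMapWithin]
  rw [mfderivWithin_of_isOpen hopen hy]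

lemma mdifferentiableAt_extChartAt_comp_symm (x₀ x₁ : M) {y : V}
    (hy : y ∈ (extChartAt 𝓘(ℝ, V) x₀).target)
    (hy' : (extChartAt 𝓘(ℝ, V) x₀).symm y ∈ (extChartAt 𝓘(ℝ, V) x₁).source) :
    MDifferentiableAt 𝓘(ℝ, V) 𝓘(ℝ, V)
      (extChartAt 𝓘(ℝ, V) x₁ ∘ (extChartAt 𝓘(ℝ, V) x₀).symm) y :=
  (((contMDiffOn_extChartAt (I := 𝓘(ℝ, V)) (n := ∞) (x := x₁)).contMDiffAt
    ((chartAt _ x₁).open_source.mem_nhds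
      (by simpa using hy'))).mdifferentiableAt (by simp)).comp y
        (mdifferentiableAt_extChartAt_symm x₀ hy)

/-- Chain rule for `φ₀.symm = φ₁.symm ∘ (φ₁ ∘ φ₀.symm)` near `y`. The values are compared in the
model space `V`, because the two tangent spaces have base points that are only propositionally
equal. -/
lemma mfderiv_extChartAt_symm_eq_comp (x₀ x₁ : M) {y : V}
    (hy : y ∈ (extChartAt 𝓘(ℝ, V) x₀).target)
    (hy' : (extChartAt 𝓘(ℝ, V) x₀).symm y ∈ (extChartAt 𝓘(ℝ, V) x₁).source) (v : V) :
    (mfderiv 𝓘(ℝ, V) 𝓘(ℝ, V) (extChartAt 𝓘(ℝ, V) x₀).symm y v : V) =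
      mfderiv 𝓘(ℝ, V) 𝓘(ℝ, V) (extChartAt 𝓘(ℝ, V) x₁).symm
        (extChartAt 𝓘(ℝ, V) x₁ ((extChartAt 𝓘(ℝ, V) x₀).symm y))
        (fderiv ℝ (extChartAt 𝓘(ℝ, V) x₁ ∘ (extChartAt 𝓘(ℝ, V) x₀).symm) y v) := by
  set φ₀ := extChartAt 𝓘(ℝ, V) x₀
  set φ₁ := extChartAt 𝓘(ℝ, V) x₁
  have hψ := mdifferentiableAt_extChartAt_comp_symm x₀ x₁ hy hy'
  have hs₁ := mdifferentiableAt_extChartAt_symm x₁ (φ₁.map_source hy')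
  have heq : φ₀.symm =ᶠ[𝓝 y] φ₁.symm ∘ (φ₁ ∘ φ₀.symm) := by
    have hc : ContinuousAt φ₀.symm y := (mdifferentiableAt_extChartAt_symm x₀ hy).continuousAt
    filter_upwards [hc.preimage_mem_nhds ((isOpen_extChartAt_source x₁).mem_nhds hy')] with z hz
    exact (φ₁.left_inv hz).symm
  have hcomp := mfderiv_comp y hs₁ hψ
  rw [← heq.mfderiv_eq, mfderiv_eq_fderiv] at hcomp
  exact congrArg (fun L : V →L[ℝ] V ↦ L v) hcomp

end Charts

/-! ### The Riemannian density and its transformation law -/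

section Volume

open Set Filter Topology

variable {n : ℕ} {X : Type*} [TopologicalSpace X] [ChartedSpace (EuclideanSpace ℝ (Fin n)) X]
  [RiemannianBundle (fun x : X ↦ TangentSpace (𝓡 n) x)]

/-- The Gram determinant of a family of vectors read in the model space of the tangent space at
`p`. -/
def gramDet (p : X) (v : Fin n → EuclideanSpace ℝ (Fin n)) : ℝ :=
  (Matrix.of fun i j : Fin n ↦
    inner ℝ (show TangentSpace (𝓡 n) p from v i) (show TangentSpace (𝓡 n) p from v j)).det

lemma volumeDensity_eq_sqrt_gramDet (x₀ : X) (y : EuclideanSpace ℝ (Fin n)) :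
    volumeDensity x₀ y = √(gramDet ((extChartAt (𝓡 n) x₀).symm y) (coordVector x₀ y)) := rfl

/-- Applying a linear map to the standard basis before a linear map `T` multiplies the Gram
determinant by the square of the determinant. -/
lemma gramDet_comp (p : X) (T J : EuclideanSpace ℝ (Fin n) →L[ℝ] EuclideanSpace ℝ (Fin n)) :
    gramDet p (fun i ↦ T (J (EuclideanSpace.single i 1))) =
      J.det ^ 2 * gramDet p (fun i ↦ T (EuclideanSpace.single i 1)) := by
  set b := (EuclideanSpace.basisFun (Fin n) ℝ).toBasis
  set M := LinearMap.toMatrix b b J.toLinearMap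
  have hM : M.det = J.det := LinearMap.det_toMatrix b _
  have hJ : ∀ i, J (EuclideanSpace.single i 1) = ∑ k, M k i • EuclideanSpace.single k (1 : ℝ) := by
    intro i
    have := b.sum_repr (J (EuclideanSpace.single i 1))
    rw [← this]
    refine Finset.sum_congr rfl fun k _ ↦ ?_
    simp [M, b, LinearMap.toMatrix_apply]
  have key : (Matrix.of fun i j : Fin n ↦
      inner ℝ (show TangentSpace (𝓡 n) p from T (J (EuclideanSpace.single i 1)))
        (show TangentSpace (𝓡 n) p from T (J (EuclideanSpace.single j 1)))) =
      M.transpose * (Matrix.of fun i j : Fin n ↦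
      inner ℝ (show TangentSpace (𝓡 n) p from T (EuclideanSpace.single i 1))
        (show TangentSpace (𝓡 n) p from T (EuclideanSpace.single j 1))) * M := by
    let T' : EuclideanSpace ℝ (Fin n) →L[ℝ] TangentSpace (𝓡 n) p := T
    ext i j
    change inner ℝ (T' (J (EuclideanSpace.single i 1))) (T' (J (EuclideanSpace.single j 1))) = _
    rw [hJ i, hJ j, map_sum, map_sum, sum_inner]
    simp only [inner_sum, map_smul, inner_smul_left, inner_smul_right, Matrix.mul_apply,
      Matrix.transpose_apply, Matrix.of_apply, Finset.sum_mul]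
    rw [Finset.sum_comm]
    refine Finset.sum_congr rfl fun k _ ↦ Finset.sum_congr rfl fun l _ ↦ ?_
    simp only [T', conj_trivial]
    exact (mul_left_comm _ _ _).trans
      ((congrArg _ (mul_comm _ _)).trans (mul_assoc _ _ _).symm)
  unfold gramDet
  rw [key, Matrix.det_mul, Matrix.det_mul, Matrix.det_transpose, hM]
  ring

variable [IsManifold (𝓡 n) ∞ X]

lemma volumeDensity_pos (x₀ : X) {y : EuclideanSpace ℝ (Fin n)}
    (hy : y ∈ (extChartAt (𝓡 n) x₀).target) : 0 < volumeDensity x₀ y := by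
  refine Real.sqrt_pos.2 ?_
  refine (Matrix.posDef_gram_of_linearIndependent (𝕜 := ℝ) (v := coordVector x₀ y) ?_).det_pos
  have h1 : LinearIndependent ℝ fun i : Fin n ↦ EuclideanSpace.single i (1 : ℝ) := by
    convert! (EuclideanSpace.basisFun (Fin n) ℝ).toBasis.linearIndependent using 1
    ext1 i
    simp
  exact h1.map' (mfderiv 𝓘(ℝ, EuclideanSpace ℝ (Fin n)) (𝓡 n)
    (extChartAt (𝓡 n) x₀).symm y).toLinearMap
    (LinearMap.ker_eq_bot.2 (mfderiv_extChartAt_symm_injective x₀ hy))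

lemma contDiffOn_volumeDensity [IsContMDiffRiemannianBundle (𝓡 n) ∞ (EuclideanSpace ℝ (Fin n))
      (fun x : X ↦ TangentSpace (𝓡 n) x)] (x₀ : X) :
    ContDiffOn ℝ ∞ (volumeDensity x₀) (extChartAt (𝓡 n) x₀).target := by
  have hv : ∀ i : Fin n, ContMDiffOn 𝓘(ℝ, EuclideanSpace ℝ (Fin n)) (𝓡 n).tangent ∞
      (fun y ↦ (⟨(extChartAt (𝓡 n) x₀).symm y, coordVector x₀ y i⟩ :
        TangentBundle (𝓡 n) X)) (extChartAt (𝓡 n) x₀).target :=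
    fun i ↦ contMDiffOn_mfderiv_extChartAt_symm x₀ _
  have hin : ∀ i j : Fin n, ContDiffOn ℝ ∞
      (fun y ↦ inner ℝ (coordVector x₀ y i) (coordVector x₀ y j)) (extChartAt (𝓡 n) x₀).target :=
    fun i j ↦ contMDiffOn_iff_contDiffOn.1
      (ContMDiffOn.inner_bundle (hv i) (hv j))
  unfold volumeDensity
  refine ContDiffOn.sqrt ?_ fun y hy ↦ (Real.sqrt_pos.1 (volumeDensity_pos x₀ hy)).ne'
  simp only [Matrix.det_apply]
  refine ContDiffOn.sum fun τ _ ↦ ContDiffOn.const_smul _ ?_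
  exact contDiffOn_prod fun i _ ↦ hin _ _

/-- The Gram matrix changes by congruence with the Jacobian of the transition map, so the square
root of its determinant picks up the absolute Jacobian determinant. -/
lemma volumeDensity_eq_abs_det_mul (x₀ x₁ : X) {y : EuclideanSpace ℝ (Fin n)}
    (hy : y ∈ (extChartAt (𝓡 n) x₀).target)
    (hy' : (extChartAt (𝓡 n) x₀).symm y ∈ (extChartAt (𝓡 n) x₁).source) :
    volumeDensity x₀ y =
      |(fderiv ℝ (extChartAt (𝓡 n) x₁ ∘ (extChartAt (𝓡 n) x₀).symm) y).det| *
        volumeDensity x₁ ((extChartAt (𝓡 n) x₁) ((extChartAt (𝓡 n) x₀).symm y)) := by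
  set φ₀ := extChartAt (𝓡 n) x₀
  set φ₁ := extChartAt (𝓡 n) x₁
  set ψ := φ₁ ∘ φ₀.symm
  have hp : φ₁.symm (ψ y) = φ₀.symm y := φ₁.left_inv hy'
  rw [volumeDensity_eq_sqrt_gramDet, volumeDensity_eq_sqrt_gramDet]
  have h1 : gramDet (φ₀.symm y) (coordVector x₀ y) =
      (fderiv ℝ ψ y).det ^ 2 * gramDet (φ₁.symm (ψ y)) (coordVector x₁ (ψ y)) := by
    rw [hp]
    refine Eq.trans ?_ (gramDet_comp (φ₀.symm y)
      (mfderiv 𝓘(ℝ, EuclideanSpace ℝ (Fin n)) (𝓡 n) φ₁.symm (ψ y)) (fderiv ℝ ψ y))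
    congr 1
    funext i
    exact mfderiv_extChartAt_symm_eq_comp x₀ x₁ hy hy' (EuclideanSpace.single i 1)
  rw [h1, Real.sqrt_mul (sq_nonneg _), Real.sqrt_sq_eq_abs]
  rfl

end Volume

/-! ### The Riemannian volume measure in a chart, and its finiteness -/

section VolumeMeasure

open Set Filter Topology

variable {n : ℕ} {X : Type*} [TopologicalSpace X] [ChartedSpace (EuclideanSpace ℝ (Fin n)) X]

lemma measurableSet_extChartAt_target (x₀ : X) :
    MeasurableSet (extChartAt (𝓡 n) x₀).target :=
  (isOpen_extChartAt_target x₀).measurableSet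

variable [RiemannianBundle (fun x : X ↦ TangentSpace (𝓡 n) x)] [MeasurableSpace X] [BorelSpace X]

lemma aemeasurable_extChartAt_symm (x₀ : X) :
    AEMeasurable (extChartAt (𝓡 n) x₀).symm
      ((volume.restrict (extChartAt (𝓡 n) x₀).target).withDensity
        fun y ↦ ENNReal.ofReal (volumeDensity x₀ y)) :=
  ((continuousOn_extChartAt_symm x₀).aemeasurable
    (measurableSet_extChartAt_target x₀)).mono_ac (withDensity_absolutelyContinuous _ _)

lemma chartVolume_apply (x₀ : X) {S : Set X} (hS : MeasurableSet S) :
    chartVolume (n := n) x₀ S =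
      ∫⁻ y in (extChartAt (𝓡 n) x₀).symm ⁻¹' S ∩ (extChartAt (𝓡 n) x₀).target,
        ENNReal.ofReal (volumeDensity x₀ y) := by
  rw [chartVolume, Measure.map_apply_of_aemeasurable (aemeasurable_extChartAt_symm x₀) hS,
    withDensity_apply', Measure.restrict_restrict' (measurableSet_extChartAt_target x₀)]

lemma chartVolume_compl_source (x₀ : X) :
    chartVolume (n := n) x₀ (extChartAt (𝓡 n) x₀).sourceᶜ = 0 := by
  rw [chartVolume_apply x₀ (isOpen_extChartAt_source x₀).measurableSet.compl]
  have : (extChartAt (𝓡 n) x₀).symm ⁻¹' (extChartAt (𝓡 n) x₀).sourceᶜ ∩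
      (extChartAt (𝓡 n) x₀).target = ∅ := by
    ext y
    simp only [mem_inter_iff, mem_preimage, mem_compl_iff, mem_empty_iff_false, iff_false, not_and]
    intro h hy
    exact h ((extChartAt (𝓡 n) x₀).map_target hy)
  rw [this]
  simp

variable [IsManifold (𝓡 n) ∞ X]

/-- Change of variables along the transition map, whose Jacobian is absorbed by the density. An
inequality is enough to identify the supremum of the chart measures on a chart domain, since the
opposite bound is part of being a supremum. -/
lemma chartVolume_inter_source_le (x₀ x₁ : X) {S : Set X} (hS : MeasurableSet S) :
    chartVolume (n := n) x₀ (S ∩ (extChartAt (𝓡 n) x₁).source) ≤ chartVolume (n := n) x₁ S := by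
  set φ₀ := extChartAt (𝓡 n) x₀
  set φ₁ := extChartAt (𝓡 n) x₁
  have hsrc : MeasurableSet (S ∩ φ₁.source) :=
    hS.inter (isOpen_extChartAt_source x₁).measurableSet
  rw [chartVolume_apply x₀ hsrc, chartVolume_apply x₁ hS]
  set s := φ₀.symm ⁻¹' (S ∩ φ₁.source) ∩ φ₀.target with hs
  have hsmeas : MeasurableSet s := by
    rw [hs, inter_comm]
    -- `φ₀.symm` is controlled only on `φ₀.target`; a constant extension makes it measurable without
    -- changing preimages there.
    obtain ⟨g, hg, hge⟩ : ∃ g : EuclideanSpace ℝ (Fin n) → X, Measurable g ∧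
        EqOn g φ₀.symm φ₀.target := by
      classical
      refine ⟨φ₀.target.piecewise φ₀.symm (fun _ ↦ x₀), ?_, piecewise_eqOn _ _ _⟩
      exact (continuousOn_extChartAt_symm x₀).measurable_piecewise continuousOn_const
        (measurableSet_extChartAt_target x₀)
    have : φ₀.target ∩ φ₀.symm ⁻¹' (S ∩ φ₁.source) = φ₀.target ∩ g ⁻¹' (S ∩ φ₁.source) := by
      ext y
      simp only [mem_inter_iff, mem_preimage]
      exact and_congr_right fun hy ↦ by rw [hge hy]
    rw [this]
    exact (measurableSet_extChartAt_target x₀).inter (hg hsrc)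
  have hderiv : ∀ y ∈ s, HasFDerivWithinAt (φ₁ ∘ φ₀.symm) (fderiv ℝ (φ₁ ∘ φ₀.symm) y) s y :=
    fun y hy ↦ (mdifferentiableAt_iff_differentiableAt.1
      (mdifferentiableAt_extChartAt_comp_symm x₀ x₁ hy.2 hy.1.2)).hasFDerivAt.hasFDerivWithinAt
  have hinj : InjOn (φ₁ ∘ φ₀.symm) s := fun y hy z hz hyz ↦
    φ₀.symm.injOn hy.2 hz.2 (φ₁.injOn hy.1.2 hz.1.2 hyz)
  calc ∫⁻ y in s, ENNReal.ofReal (volumeDensity x₀ y)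
      = ∫⁻ y in s, ENNReal.ofReal |(fderiv ℝ (φ₁ ∘ φ₀.symm) y).det| *
          ENNReal.ofReal (volumeDensity x₁ ((φ₁ ∘ φ₀.symm) y)) := by
        refine setLIntegral_congr_fun hsmeas fun y hy ↦ ?_
        rw [volumeDensity_eq_abs_det_mul x₀ x₁ hy.2 hy.1.2, ENNReal.ofReal_mul (abs_nonneg _)]
        rfl
    _ = ∫⁻ z in (φ₁ ∘ φ₀.symm) '' s, ENNReal.ofReal (volumeDensity x₁ z) :=
        (lintegral_image_eq_lintegral_abs_det_fderiv_mul volume hsmeas hderiv hinj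
          (fun z ↦ ENNReal.ofReal (volumeDensity x₁ z))).symm
    _ ≤ ∫⁻ z in φ₁.symm ⁻¹' S ∩ φ₁.target, ENNReal.ofReal (volumeDensity x₁ z) := by
        refine lintegral_mono_set ?_
        rintro _ ⟨y, hy, rfl⟩
        refine ⟨?_, φ₁.map_source hy.1.2⟩
        simp only [mem_preimage, Function.comp]
        rw [φ₁.left_inv hy.1.2]
        exact hy.1.1

/-- On the domain of a chart the Riemannian volume is the chart measure. -/
lemma riemannianVolume_restrict_source (x₀ : X) :
    (riemannianVolume n X).restrict (extChartAt (𝓡 n) x₀).source =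
      chartVolume (n := n) x₀ := by
  have hsrc : MeasurableSet (extChartAt (𝓡 n) x₀).source :=
    (isOpen_extChartAt_source x₀).measurableSet
  apply le_antisymm
  -- The crude bound `⊤` off the chart domain disappears on restriction to the domain.
  · have hle : riemannianVolume n X ≤
        chartVolume (n := n) x₀ + (⊤ : Measure X).restrict (extChartAt (𝓡 n) x₀).sourceᶜ := by
      refine iSup_le fun x ↦ Measure.le_iff.2 fun S hS ↦ ?_
      rw [← measure_inter_add_sdiff S hsrc, Measure.add_apply, Measure.restrict_apply hS]
      exact add_le_add (chartVolume_inter_source_le x x₀ hS)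
        ((le_top : chartVolume (n := n) x ≤ ⊤) _)
    refine (Measure.restrict_mono le_rfl hle).trans ?_
    rw [Measure.restrict_add, Measure.restrict_restrict hsrc, inter_compl_self,
      Measure.restrict_empty, add_zero]
    exact Measure.restrict_le_self
  · rw [← Measure.restrict_eq_self_of_ae_mem (μ := chartVolume (n := n) x₀)
      (s := (extChartAt (𝓡 n) x₀).source) (chartVolume_compl_source x₀)]
    exact Measure.restrict_mono le_rfl (le_iSup (fun x ↦ chartVolume (n := n) x) x₀)

variable [IsContMDiffRiemannianBundle (𝓡 n) ∞ (EuclideanSpace ℝ (Fin n))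
      (fun x : X ↦ TangentSpace (𝓡 n) x)]

/-- Integration against the Riemannian volume in a chart. -/
lemma setIntegral_source_riemannianVolume (x₀ : X) {g : X → ℝ} (hg : Continuous g) :
    ∫ x in (extChartAt (𝓡 n) x₀).source, g x ∂(riemannianVolume n X) =
      ∫ y in (extChartAt (𝓡 n) x₀).target,
        volumeDensity x₀ y * g ((extChartAt (𝓡 n) x₀).symm y) := by
  rw [riemannianVolume_restrict_source, chartVolume,
    integral_map (aemeasurable_extChartAt_symm x₀) hg.measurable.aestronglyMeasurable,
    integral_withDensity_eq_integral_toReal_smul₀]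
  · refine integral_congr_ae (Eventually.of_forall fun y ↦ ?_)
    have h0 : 0 ≤ volumeDensity x₀ y := Real.sqrt_nonneg _
    simp only [smul_eq_mul, ENNReal.toReal_ofReal h0]
  · exact ((contDiffOn_volumeDensity x₀).continuousOn.aemeasurable
      (measurableSet_extChartAt_target x₀)).ennreal_ofReal
  · exact Eventually.of_forall fun _ ↦ ENNReal.ofReal_lt_top

/-- The density is continuous, hence integrable over compact coordinate neighbourhoods; local
finiteness and compactness of `X` give finiteness. -/
instance isFiniteMeasure_riemannianVolume [CompactSpace X] :
    IsFiniteMeasure (riemannianVolume n X) := by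
  have : IsLocallyFiniteMeasure (riemannianVolume n X) := by
    refine ⟨fun x ↦ ?_⟩
    set φ := extChartAt (𝓡 n) x
    obtain ⟨K, hK, hKx, hKt⟩ := exists_compact_subset (isOpen_extChartAt_target (I := 𝓡 n) x)
      (mem_extChartAt_target (I := 𝓡 n) x)
    have hopen : IsOpen (φ.source ∩ φ ⁻¹' interior K) :=
      isOpen_extChartAt_preimage' x isOpen_interior
    refine ⟨φ.source ∩ φ ⁻¹' interior K, hopen.mem_nhds ⟨mem_extChartAt_source x, hKx⟩, ?_⟩
    rw [← Measure.restrict_eq_self (riemannianVolume n X) inter_subset_left,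
      riemannianVolume_restrict_source, chartVolume_apply x hopen.measurableSet]
    calc _ ≤ ∫⁻ y in K, ENNReal.ofReal (volumeDensity x y) := by
          refine lintegral_mono_set ?_
          rintro y ⟨⟨-, hy⟩, hyt⟩
          have : φ (φ.symm y) ∈ interior K := hy
          rw [φ.right_inv hyt] at this
          exact interior_subset this
      _ < ⊤ := (((contDiffOn_volumeDensity x).continuousOn.mono hKt).integrableOn_compact
          hK).setLIntegral_lt_top
  exact CompactSpace.isFiniteMeasure

end VolumeMeasure

/-! ### Integration by parts in Euclidean space -/

section Euclidean

open Set Filter Topology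

variable {V : Type*} [NormedAddCommGroup V]

lemma integrable_mul_of_tsupport_subset [MeasurableSpace V] [BorelSpace V] {μ : Measure V}
    [IsFiniteMeasureOnCompacts μ] {U K : Set V} (hU : IsOpen U) (hK : IsCompact K) (hKU : K ⊆ U)
    {F h : V → ℝ} (hF : ContinuousOn F U) (hh : Continuous h) (hs : tsupport h ⊆ K) :
    Integrable (fun y ↦ F y * h y) μ := by
  have hsup : tsupport (fun y ↦ F y * h y) ⊆ tsupport h := tsupport_mul_subset_right
  refine Continuous.integrable_of_hasCompactSupport ?_
    (hK.of_isClosed_subset (isClosed_tsupport _) (hsup.trans hs))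
  exact continuous_of_tsupport fun y hy ↦
    (hF.continuousAt (hU.mem_nhds (hKU (hs (hsup hy))))).mul hh.continuousAt

/-- Integrating a directional derivative of a function supported in a fixed compact set against a
smooth weight loses no derivative. -/
lemma exists_abs_setIntegral_fderiv_le [NormedSpace ℝ V] [FiniteDimensional ℝ V]
    [MeasurableSpace V] [BorelSpace V] (μ : Measure V) [μ.IsAddHaarMeasure] {U K : Set V} (hU : IsOpen U) (hK : IsCompact K)
    (hKU : K ⊆ U) {G w : V → ℝ} (hG : ContDiffOn ℝ ∞ G U) (hw : ContinuousOn w U)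
    (hw0 : ∀ y ∈ U, 0 < w y) (v : V) :
    ∃ C : ℝ, 0 ≤ C ∧ ∀ h : V → ℝ, ContDiff ℝ ∞ h → tsupport h ⊆ K →
      IntegrableOn (fun y ↦ G y * fderiv ℝ h y v) U μ ∧
      |∫ y in U, G y * fderiv ℝ h y v ∂μ| ≤ C * ∫ y in U, w y * |h y| ∂μ := by
  have hG' : ContinuousOn (fun y ↦ fderiv ℝ G y v) U :=
    (hG.continuousOn_fderiv_of_isOpen hU (by simp)).clm_apply continuousOn_const
  -- The constant bounds `|∂_v G| / w` on `K`, so that `|∂_v G|` can be traded for the weight `w`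
  -- after integrating by parts.
  obtain ⟨C, hC⟩ := hK.exists_bound_of_continuousOn
    ((hG'.div hw fun y hy ↦ (hw0 y hy).ne').mono hKU)
  refine ⟨|C|, abs_nonneg _, fun h hh hs ↦ ?_⟩
  have hh' : Continuous fun y ↦ fderiv ℝ h y v :=
    (hh.continuous_fderiv (by simp)).clm_apply continuous_const
  have hsf : tsupport (fun y ↦ fderiv ℝ h y v) ⊆ tsupport h := by
    refine closure_minimal (fun y hy ↦ ?_) (isClosed_tsupport _)
    refine support_fderiv_subset ℝ (f := h) fun h0 ↦ hy ?_
    simp [h0]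
  have i1 : Integrable (fun y ↦ G y * fderiv ℝ h y v) μ :=
    integrable_mul_of_tsupport_subset hU hK hKU hG.continuousOn hh' (hsf.trans hs)
  have i2 : Integrable (fun y ↦ fderiv ℝ G y v * h y) μ :=
    integrable_mul_of_tsupport_subset hU hK hKU hG' hh.continuous hs
  have i3 : Integrable (fun y ↦ G y * h y) μ :=
    integrable_mul_of_tsupport_subset hU hK hKU hG.continuousOn hh.continuous hs
  have habs : tsupport (fun y ↦ |h y|) ⊆ K := by
    have : Function.support (fun y ↦ |h y|) = Function.support h := by ext y; simp
    rwa [tsupport, this]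
  have i4 : Integrable (fun y ↦ w y * |h y|) μ :=
    integrable_mul_of_tsupport_subset hU hK hKU hw hh.continuous.abs habs
  have hzero : ∀ y, y ∉ U → h y = 0 := fun y hy ↦
    image_eq_zero_of_notMem_tsupport fun h' ↦ hy (hKU (hs h'))
  have hzero' : ∀ y, y ∉ U → fderiv ℝ h y v = 0 := fun y hy ↦
    image_eq_zero_of_notMem_tsupport (f := fun y ↦ fderiv ℝ h y v)
      fun h' ↦ hy (hKU (hs (hsf h')))
  refine ⟨i1.integrableOn, ?_⟩
  -- Since `h` is supported in `K ⊆ U`, the integrals extend to the whole space and no boundary term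
  -- appears.
  rw [setIntegral_eq_integral_of_forall_compl_eq_zero fun y hy ↦ by rw [hzero' y hy, mul_zero],
    setIntegral_eq_integral_of_forall_compl_eq_zero
      fun y hy ↦ by rw [hzero y hy, abs_zero, mul_zero],
    integral_mul_fderiv_eq_neg_fderiv_mul_of_integrable i2 i1 i3
      (fun y hy ↦ ((hG.differentiableOn (by simp)) y (hKU (hs hy))).differentiableAt
        (hU.mem_nhds (hKU (hs hy))))
      (fun y _ ↦ hh.differentiable (by simp) y), abs_neg, ← integral_const_mul]
  refine abs_integral_le_integral_abs.trans (integral_mono i2.abs (i4.const_mul _) fun y ↦ ?_)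
  simp only [abs_mul]
  by_cases hy : y ∈ K
  · have h1 := (hC y hy).trans (le_abs_self C)
    have hwy := hw0 y (hKU hy)
    rw [Pi.div_apply, Real.norm_eq_abs, abs_div, abs_of_pos hwy, div_le_iff₀ hwy] at h1
    calc _ ≤ |C| * w y * |h y| := mul_le_mul_of_nonneg_right h1 (abs_nonneg _)
      _ = _ := by ring
  · have : h y = 0 := image_eq_zero_of_notMem_tsupport fun h' ↦ hy (hs h')
    simp [this]

end Euclidean

/-! ### Functions on the manifold read in a chart -/

section ChartFunctions

open Set Filter Topology

variable {V : Type*} [NormedAddCommGroup V] [NormedSpace ℝ V]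
  {M : Type*} [TopologicalSpace M] [ChartedSpace V M]

/-- The image of the compact support is closed in `V`, so extension by zero acquires no support at
the boundary of the chart target. -/
lemma tsupport_indicator_comp_extChartAt_symm_subset (x₀ : M) {g : M → ℝ}
    (hc : HasCompactSupport g) (hs : tsupport g ⊆ (extChartAt 𝓘(ℝ, V) x₀).source) :
    tsupport ((extChartAt 𝓘(ℝ, V) x₀).target.indicator (g ∘ (extChartAt 𝓘(ℝ, V) x₀).symm)) ⊆
      extChartAt 𝓘(ℝ, V) x₀ '' tsupport g := by
  have hK : IsCompact (extChartAt 𝓘(ℝ, V) x₀ '' tsupport g) :=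
    hc.isCompact.image_of_continuousOn ((continuousOn_extChartAt x₀).mono hs)
  refine closure_minimal (fun y hy ↦ ?_) hK.isClosed
  have hy' := support_indicator.subset hy
  exact ⟨_, subset_tsupport _ hy'.2, (extChartAt 𝓘(ℝ, V) x₀).right_inv hy'.1⟩

variable [IsManifold 𝓘(ℝ, V) ∞ M]

lemma contDiffOn_comp_extChartAt_symm (x₀ : M) {g : M → ℝ} (hg : ContMDiff 𝓘(ℝ, V) 𝓘(ℝ, ℝ) ∞ g) :
    ContDiffOn ℝ ∞ (g ∘ (extChartAt 𝓘(ℝ, V) x₀).symm) (extChartAt 𝓘(ℝ, V) x₀).target :=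
  contMDiffOn_iff_contDiffOn.1 (hg.comp_contMDiffOn (contMDiffOn_extChartAt_symm x₀))

/-- The differential of a function in terms of its expression in a chart. -/
lemma mvfderiv_apply_eq_fderiv_extChartAt (x₀ : M) {g : M → ℝ}
    (hg : ContMDiff 𝓘(ℝ, V) 𝓘(ℝ, ℝ) ∞ g) {x : M} (hx : x ∈ (extChartAt 𝓘(ℝ, V) x₀).source)
    (v : TangentSpace 𝓘(ℝ, V) x) :
    mvfderiv 𝓘(ℝ, V) g x v = fderiv ℝ (g ∘ (extChartAt 𝓘(ℝ, V) x₀).symm)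
      (extChartAt 𝓘(ℝ, V) x₀ x)
      (mfderiv 𝓘(ℝ, V) 𝓘(ℝ, V) (extChartAt 𝓘(ℝ, V) x₀) x v) := by
  set φ := extChartAt 𝓘(ℝ, V) x₀
  have hφ : MDifferentiableAt 𝓘(ℝ, V) 𝓘(ℝ, V) φ x :=
    mdifferentiableAt_extChartAt (by simpa [φ] using hx)
  have hG : MDifferentiableAt 𝓘(ℝ, V) 𝓘(ℝ, ℝ) (g ∘ φ.symm) (φ x) :=
    (hg.mdifferentiableAt (by simp)).comp _
      (mdifferentiableAt_extChartAt_symm x₀ (φ.map_source hx))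
  have heq : g =ᶠ[𝓝 x] (g ∘ φ.symm) ∘ φ := by
    filter_upwards [(isOpen_extChartAt_source x₀).mem_nhds hx] with z hz
    simp only [Function.comp]
    rw [φ.left_inv hz]
  have h1 : mfderiv 𝓘(ℝ, V) 𝓘(ℝ, ℝ) g x = mfderiv 𝓘(ℝ, V) 𝓘(ℝ, ℝ) ((g ∘ φ.symm) ∘ φ) x :=
    heq.mfderiv_eq
  rw [mfderiv_comp x hG hφ, mfderiv_eq_fderiv] at h1
  exact congrArg (fun L : V →L[ℝ] ℝ ↦ L v) h1

lemma contDiff_indicator_comp_extChartAt_symm (x₀ : M) {g : M → ℝ}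
    (hg : ContMDiff 𝓘(ℝ, V) 𝓘(ℝ, ℝ) ∞ g)
    (hc : HasCompactSupport g) (hs : tsupport g ⊆ (extChartAt 𝓘(ℝ, V) x₀).source) :
    ContDiff ℝ ∞
      ((extChartAt 𝓘(ℝ, V) x₀).target.indicator (g ∘ (extChartAt 𝓘(ℝ, V) x₀).symm)) := by
  refine contMDiff_iff_contDiff.1 (contMDiff_of_tsupport fun y hy ↦ ?_)
  obtain ⟨x, hx, rfl⟩ := tsupport_indicator_comp_extChartAt_symm_subset x₀ hc hs hy
  have ht : (extChartAt 𝓘(ℝ, V) x₀).target ∈ 𝓝 (extChartAt 𝓘(ℝ, V) x₀ x) :=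
    (isOpen_extChartAt_target x₀).mem_nhds ((extChartAt 𝓘(ℝ, V) x₀).map_source (hs hx))
  exact (((contDiffOn_comp_extChartAt_symm x₀ hg).contDiffAt ht).congr_of_eventuallyEq
    (eventually_of_mem ht fun z hz ↦ indicator_of_mem hz _)).contMDiffAt

end ChartFunctions

/-! ### Partitions of unity and cutoffs -/

section Partition

open Set Filter Topology

variable {V : Type*} [NormedAddCommGroup V] [NormedSpace ℝ V] [FiniteDimensional ℝ V]
  {M : Type*} [TopologicalSpace M] [ChartedSpace V M] [IsManifold 𝓘(ℝ, V) ∞ M]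
  [T2Space M] [CompactSpace M]

/-- A finite smooth partition of unity subordinate to a family of neighbourhoods. -/
lemma exists_finite_partition (U : M → Set M) (hU : ∀ x, IsOpen (U x)) (hxU : ∀ x, x ∈ U x) :
    ∃ (t : Finset M) (ρ : t → C^∞⟮𝓘(ℝ, V), M; ℝ⟯), (∀ x, ∑ i, ρ i x = 1) ∧
      (∀ i x, |ρ i x| ≤ 1) ∧ ∀ i, tsupport (ρ i) ⊆ U i := by
  obtain ⟨t, ht⟩ := isCompact_univ.elim_finite_subcover U hU
    (fun x _ ↦ mem_iUnion.2 ⟨x, hxU x⟩)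
  obtain ⟨ρ, hρ⟩ := SmoothPartitionOfUnity.exists_isSubordinate 𝓘(ℝ, V) isClosed_univ
    (fun i : t ↦ U i) (fun i ↦ hU i) (fun x hx ↦ by simpa using ht hx)
  refine ⟨t, fun i ↦ ρ i, fun x ↦ ?_, fun i x ↦ ?_, hρ⟩
  · rw [← finsum_eq_sum_of_fintype]
    exact ρ.sum_eq_one (mem_univ x)
  · rw [abs_of_nonneg (ρ.nonneg i x)]
    exact ρ.le_one i x

/-- A smooth cutoff function which is one near a closed subset of an open set. -/
lemma exists_cutoff {K U : Set M} (hK : IsClosed K) (hU : IsOpen U) (hKU : K ⊆ U) :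
    ∃ χ : C^∞⟮𝓘(ℝ, V), M; ℝ⟯, (∀ x ∈ K, ∀ᶠ z in 𝓝 x, χ z = 1) ∧ tsupport χ ⊆ U := by
  obtain ⟨u, hu, hKu, huU⟩ := normal_exists_closure_subset hK hU hKU
  obtain ⟨χ, h1, h0, -⟩ := exists_contMDiffMap_one_nhds_of_subset_interior (n := ⊤) 𝓘(ℝ, V) hK
    (hKu.trans (interior_maximal subset_closure hu))
  refine ⟨χ, fun x hx ↦ h1.filter_mono (nhds_le_nhdsSet hx), ?_⟩
  refine (closure_minimal (fun x hx ↦ ?_) isClosed_closure).trans huU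
  by_contra h
  exact hx (h0 x h)

end Partition

/-! ### A weak divergence theorem -/

section Divergence

open Set Filter Topology

variable {n : ℕ} {X : Type*} [TopologicalSpace X]
  [ChartedSpace (EuclideanSpace ℝ (Fin n)) X] [IsManifold (𝓡 n) ∞ X]

/-- The coordinates are replaced by global smooth functions because the forms `L` integrated below
are only known to be smooth on differentials of such functions. -/
lemma mvfderiv_eq_sum_coordinates (x₀ : X) (g : C^∞⟮𝓡 n, X; ℝ⟯) (y : Fin n → C^∞⟮𝓡 n, X; ℝ⟯)
    {x : X} (hx : x ∈ (extChartAt (𝓡 n) x₀).source)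
    (hy : ∀ i, ∀ᶠ z in 𝓝 x, y i z = extChartAt (𝓡 n) x₀ z i) :
    mvfderiv (𝓡 n) g x = ∑ i, fderiv ℝ (g ∘ (extChartAt (𝓡 n) x₀).symm) (extChartAt (𝓡 n) x₀ x)
      (EuclideanSpace.single i 1) • mvfderiv (𝓡 n) (y i) x := by
  ext v
  set φ := extChartAt (𝓡 n) x₀
  set u : EuclideanSpace ℝ (Fin n) := mfderiv (𝓡 n) 𝓘(ℝ, EuclideanSpace ℝ (Fin n)) φ x v
  have h1 : mvfderiv (𝓡 n) g x v = fderiv ℝ (g ∘ φ.symm) (φ x) u :=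
    mvfderiv_apply_eq_fderiv_extChartAt x₀ g.contMDiff hx v
  have h2 : ∀ i, mvfderiv (𝓡 n) (y i) x v = u i := by
    intro i
    have h3 : mvfderiv (𝓡 n) (y i) x v = fderiv ℝ (y i ∘ φ.symm) (φ x) u :=
      mvfderiv_apply_eq_fderiv_extChartAt x₀ (y i).contMDiff hx v
    have hc : ContinuousAt φ.symm (φ x) := continuousAt_extChartAt_symm' hx
    have h4 : y i ∘ φ.symm =ᶠ[𝓝 (φ x)] EuclideanSpace.proj (𝕜 := ℝ) i := by
      have h5 : ∀ᶠ z in 𝓝 (φ.symm (φ x)), y i z = φ z i := by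
        rw [φ.left_inv hx]; exact hy i
      filter_upwards [hc.eventually h5,
        (isOpen_extChartAt_target (I := 𝓡 n) x₀).mem_nhds (φ.map_source hx)] with z hz hzt
      simp only [Function.comp, hz]
      rw [φ.right_inv hzt]
      rfl
    rw [h3, h4.fderiv_eq, ContinuousLinearMap.fderiv]
    rfl
  have hu : u = ∑ i, u i • EuclideanSpace.single i (1 : ℝ) := by
    have := (EuclideanSpace.basisFun (Fin n) ℝ).sum_repr u
    simpa using this.symm
  rw [h1]
  conv_lhs => rw [hu]
  rw [map_sum, _root_.sum_apply]
  refine Finset.sum_congr rfl fun i _ ↦ ?_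
  rw [map_smul, smul_eq_mul, mul_comm]
  exact congrArg _ (h2 i).symm

variable [T2Space X] [CompactSpace X]

/-- Cut-off coordinate functions of a chart, which agree with the coordinates near a given closed
subset of its domain. -/
lemma exists_coordinates (x₀ : X) {K : Set X} (hK : IsClosed K)
    (hKs : K ⊆ (extChartAt (𝓡 n) x₀).source) :
    ∃ y : Fin n → C^∞⟮𝓡 n, X; ℝ⟯, ∀ i, ∀ x ∈ K, ∀ᶠ z in 𝓝 x,
      y i z = extChartAt (𝓡 n) x₀ z i := by
  obtain ⟨χ, h1, hs⟩ := exists_cutoff (V := EuclideanSpace ℝ (Fin n)) hK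
    (isOpen_extChartAt_source x₀) hKs
  have hsm : ∀ i : Fin n, ContMDiff (𝓡 n) 𝓘(ℝ, ℝ) ∞
      (fun z ↦ χ z * extChartAt (𝓡 n) x₀ z i) := by
    intro i
    refine contMDiff_of_tsupport fun z hz ↦ ?_
    have hz' : z ∈ (chartAt (EuclideanSpace ℝ (Fin n)) x₀).source := by
      simpa using hs (tsupport_mul_subset_left hz)
    exact χ.contMDiff.contMDiffAt.mul
      ((EuclideanSpace.proj (𝕜 := ℝ) i).contDiff.contMDiff.contMDiffAt.comp z
        (contMDiffAt_extChartAt' hz'))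
  refine ⟨fun i ↦ ⟨_, hsm i⟩, fun i x hx ↦ ?_⟩
  filter_upwards [h1 x hx] with z hz
  simp [hz]

variable [RiemannianBundle (fun x : X ↦ TangentSpace (𝓡 n) x)]
  [IsContMDiffRiemannianBundle (𝓡 n) ∞ (EuclideanSpace ℝ (Fin n))
      (fun x : X ↦ TangentSpace (𝓡 n) x)]
  [MeasurableSpace X] [BorelSpace X]

/-- In the chart the integrand is `∑ G i * ∂ᵢ h`, where `G i` is the density times `L (dyᵢ)`, smooth
by `hL`, and `h` is `ρ * f` extended by zero. Its support lies in a compact set fixed by `ρ`, so the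
constants do not depend on `f`. -/
lemma exists_abs_integral_derivation_mul_le_of_tsupport
    (L : ∀ x : X, (TangentSpace (𝓡 n) x →L[ℝ] ℝ) →ₗ[ℝ] ℝ)
    (hL : ∀ f : C^∞⟮𝓡 n, X; ℝ⟯,
      ContMDiff (𝓡 n) 𝓘(ℝ, ℝ) ∞ fun x ↦ L x (mvfderiv (𝓡 n) f x))
    (x₀ : X) (ρ : C^∞⟮𝓡 n, X; ℝ⟯) (hρ1 : ∀ x, |ρ x| ≤ 1)
    (hρ : tsupport ρ ⊆ (extChartAt (𝓡 n) x₀).source) :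
    ∃ C : ℝ, 0 ≤ C ∧ ∀ f : C^∞⟮𝓡 n, X; ℝ⟯,
      |∫ x, L x (mvfderiv (𝓡 n) (ρ * f : C^∞⟮𝓡 n, X; ℝ⟯) x) ∂(riemannianVolume n X)| ≤
        C * ∫ x, |f x| ∂(riemannianVolume n X) := by
  set φ := extChartAt (𝓡 n) x₀
  obtain ⟨y, hy⟩ := exists_coordinates x₀ (isClosed_tsupport ρ) hρ
  have hK : IsCompact (φ '' tsupport ρ) :=
    (isClosed_tsupport ρ).isCompact.image_of_continuousOn ((continuousOn_extChartAt x₀).mono hρ)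
  have hKU : φ '' tsupport ρ ⊆ φ.target := by
    rintro _ ⟨x, hx, rfl⟩
    exact φ.map_source (hρ hx)
  have hopen : IsOpen φ.target := isOpen_extChartAt_target x₀
  let G : Fin n → EuclideanSpace ℝ (Fin n) → ℝ := fun i z ↦
    volumeDensity x₀ z * L (φ.symm z) (mvfderiv (𝓡 n) (y i) (φ.symm z))
  have hG : ∀ i, ContDiffOn ℝ ∞ (G i) φ.target := fun i ↦
    (contDiffOn_volumeDensity x₀).mul (contDiffOn_comp_extChartAt_symm x₀ (hL (y i)))
  choose C hC0 hC using fun i ↦ exists_abs_setIntegral_fderiv_le volume hopen hK hKU (hG i)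
    (contDiffOn_volumeDensity x₀).continuousOn (fun z hz ↦ volumeDensity_pos x₀ hz)
    (EuclideanSpace.single i (1 : ℝ))
  refine ⟨∑ i, C i, Finset.sum_nonneg fun i _ ↦ hC0 i, fun f ↦ ?_⟩
  set g : C^∞⟮𝓡 n, X; ℝ⟯ := ρ * f
  have hgs : tsupport g ⊆ tsupport ρ := tsupport_mul_subset_left
  set h := φ.target.indicator (g ∘ φ.symm) with hh
  have hcs : HasCompactSupport g := (isClosed_tsupport g).isCompact
  have hhs : tsupport h ⊆ φ '' tsupport g :=
    tsupport_indicator_comp_extChartAt_symm_subset x₀ hcs (hgs.trans hρ)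
  have hhs' : tsupport h ⊆ φ '' tsupport ρ := hhs.trans (image_mono hgs)
  have hhd : ContDiff ℝ ∞ h :=
    contDiff_indicator_comp_extChartAt_symm x₀ g.contMDiff hcs (hgs.trans hρ)
  have hfd : ∀ z ∈ φ.target, fderiv ℝ (g ∘ φ.symm) z = fderiv ℝ h z := fun z hz ↦
    (Filter.EventuallyEq.fderiv_eq (eventually_of_mem (hopen.mem_nhds hz)
      fun w hw ↦ indicator_of_mem hw _)).symm
  have hoff : ∀ x, x ∉ tsupport g → mvfderiv (𝓡 n) g x = 0 := by
    intro x hx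
    have : (g : X → ℝ) =ᶠ[𝓝 x] fun _ ↦ (0 : ℝ) := notMem_tsupport_iff_eventuallyEq.1 hx
    ext v
    simp only [mvfderiv, this.mfderiv_eq, mfderiv_const]
    exact map_zero (NormedSpace.fromTangentSpace (𝕜 := ℝ) (g x))
  have hpt : ∀ z ∈ φ.target, volumeDensity x₀ z * L (φ.symm z) (mvfderiv (𝓡 n) g (φ.symm z)) =
      ∑ i, G i z * fderiv ℝ h z (EuclideanSpace.single i 1) := by
    intro z hz
    by_cases hzs : φ.symm z ∈ tsupport ρ
    · rw [mvfderiv_eq_sum_coordinates x₀ g y (φ.map_target hz) (fun i ↦ hy i _ hzs), map_sum,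
        Finset.mul_sum]
      refine Finset.sum_congr rfl fun i _ ↦ ?_
      rw [map_smul, smul_eq_mul]
      change _ * (fderiv ℝ (g ∘ φ.symm) (φ (φ.symm z)) _ * _) = _
      rw [φ.right_inv hz, hfd z hz]
      simp only [G]
      ring
    · have hz0 : fderiv ℝ h z = 0 := by
        by_contra h0
        obtain ⟨x, hx, hxz⟩ := hhs' (support_fderiv_subset ℝ h0)
        refine hzs ?_
        rw [← hxz, φ.left_inv (hρ hx)]
        exact hx
      rw [hoff _ fun h' ↦ hzs (hgs h'), map_zero, mul_zero]
      simp [hz0]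
  have hint : ∫ x, L x (mvfderiv (𝓡 n) g x) ∂(riemannianVolume n X) =
      ∑ i, ∫ z in φ.target, G i z * fderiv ℝ h z (EuclideanSpace.single i 1) := by
    rw [← setIntegral_eq_integral_of_forall_compl_eq_zero (s := φ.source) fun x hx ↦ by
        rw [hoff x fun h' ↦ hx (hρ (hgs h')), map_zero],
      setIntegral_source_riemannianVolume x₀ (hL g).continuous,
      setIntegral_congr_fun hopen.measurableSet hpt,
      integral_finsetSum _ fun i _ ↦ (hC i h hhd hhs').1]
  have hle : ∫ z in φ.target, volumeDensity x₀ z * |h z| ≤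
      ∫ x, |f x| ∂(riemannianVolume n X) := by
    have h1 : ∫ z in φ.target, volumeDensity x₀ z * |h z| =
        ∫ z in φ.target, volumeDensity x₀ z * |g (φ.symm z)| :=
      setIntegral_congr_fun hopen.measurableSet fun z hz ↦ by
        simp only [hh, indicator_of_mem hz, Function.comp]
    rw [h1, ← setIntegral_source_riemannianVolume x₀ (g := fun x ↦ |g x|)
      g.contMDiff.continuous.abs]
    have hgi : Integrable (fun x ↦ |g x|) (riemannianVolume n X) :=
      g.contMDiff.continuous.abs.integrable_of_hasCompactSupport
        (isClosed_tsupport _).isCompact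
    have hfi : Integrable (fun x ↦ |f x|) (riemannianVolume n X) :=
      f.contMDiff.continuous.abs.integrable_of_hasCompactSupport
        (isClosed_tsupport _).isCompact
    refine (setIntegral_le_integral hgi (Eventually.of_forall fun x ↦ abs_nonneg _)).trans
      (integral_mono hgi hfi fun x ↦ ?_)
    have : g x = ρ x * f x := rfl
    simp only [this, abs_mul]
    exact mul_le_of_le_one_left (abs_nonneg _) (hρ1 x)
  rw [hint, Finset.sum_mul]
  refine (Finset.abs_sum_le_sum_abs _ _).trans (Finset.sum_le_sum fun i _ ↦ ?_)
  exact ((hC i h hhd hhs').2).trans (mul_le_mul_of_nonneg_left hle (hC0 i))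

/-- A weak form of the divergence theorem on a closed manifold: integrating the derivative of a
function along a smooth vector field loses no derivative. The vector field is given as a family of
linear forms on the cotangent spaces. -/
lemma exists_abs_integral_derivation_le
    (L : ∀ x : X, (TangentSpace (𝓡 n) x →L[ℝ] ℝ) →ₗ[ℝ] ℝ)
    (hL : ∀ f : C^∞⟮𝓡 n, X; ℝ⟯,
      ContMDiff (𝓡 n) 𝓘(ℝ, ℝ) ∞ fun x ↦ L x (mvfderiv (𝓡 n) f x)) :
    ∃ C : ℝ, 0 ≤ C ∧ ∀ f : C^∞⟮𝓡 n, X; ℝ⟯,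
      |∫ x, L x (mvfderiv (𝓡 n) f x) ∂(riemannianVolume n X)| ≤
        C * ∫ x, |f x| ∂(riemannianVolume n X) := by
  obtain ⟨t, ρ, hsum, h1, hs⟩ := exists_finite_partition (V := EuclideanSpace ℝ (Fin n))
    (fun x : X ↦ (extChartAt (𝓡 n) x).source) (fun x ↦ isOpen_extChartAt_source x)
    (fun x ↦ mem_extChartAt_source x)
  choose C hC0 hC using fun i : t ↦ exists_abs_integral_derivation_mul_le_of_tsupport L hL i (ρ i)
    (h1 i) (hs i)
  refine ⟨∑ i, C i, Finset.sum_nonneg fun i _ ↦ hC0 i, fun f ↦ ?_⟩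
  -- The partition is placed inside the differential, so that each summand differentiates a function
  -- supported in one chart.
  have hf : f = ∑ i, ρ i * f := by
    ext x
    have : (∑ i, ρ i * f) x = ∑ i, (ρ i x * f x) := by
      rw [← ContMDiffMap.coeFnAddMonoidHom_apply, map_sum, Finset.sum_apply]
      rfl
    rw [this, ← Finset.sum_mul, hsum, one_mul]
  have hpt : ∀ x, L x (mvfderiv (𝓡 n) f x) =
      ∑ i, L x (mvfderiv (𝓡 n) (ρ i * f : C^∞⟮𝓡 n, X; ℝ⟯) x) := by
    intro x
    let T : C^∞⟮𝓡 n, X; ℝ⟯ →+ ℝ := AddMonoidHom.mk' (fun g ↦ L x (mvfderiv (𝓡 n) g x))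
      fun g g' ↦ by
        rw [ContMDiffMap.coe_add, mvfderiv_add (g.contMDiff.mdifferentiableAt (by simp))
          (g'.contMDiff.mdifferentiableAt (by simp)), map_add]
    exact (congrArg T hf).trans (map_sum T _ _)
  rw [integral_congr_ae (Eventually.of_forall hpt), integral_finsetSum _ fun i _ ↦
    (hL (ρ i * f)).continuous.integrable_of_hasCompactSupport (isClosed_tsupport _).isCompact,
    Finset.sum_mul]
  exact (Finset.abs_sum_le_sum_abs _ _).trans (Finset.sum_le_sum fun i _ ↦ hC i f)

end Divergence

/-! ### Lower bounds for bundle maps and generating sections -/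

section Bundles

open Set Filter Topology

universe u

variable {n : ℕ} {X : Type u} [TopologicalSpace X] [ChartedSpace (EuclideanSpace ℝ (Fin n)) X]
  {VE : Type*} [NormedAddCommGroup VE] [NormedSpace ℝ VE]
  {E : X → Type*} [TopologicalSpace (TotalSpace VE E)] [∀ x, NormedAddCommGroup (E x)]
  [∀ x, InnerProductSpace ℝ (E x)] [FiberBundle VE E] [VectorBundle ℝ VE E]

lemma isContinuousRiemannianBundle_of_contMDiff
    (h : IsContMDiffRiemannianBundle (𝓡 n) ∞ VE E) : IsContinuousRiemannianBundle VE E := by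
  obtain ⟨g, hg, hin⟩ := h.exists_contMDiff
  exact ⟨g, hg.continuous, hin⟩

variable [IsContMDiffRiemannianBundle (𝓡 n) ∞ VE E]
  {VF : Type*} [NormedAddCommGroup VF] [NormedSpace ℝ VF]
  {F : X → Type*} [TopologicalSpace (TotalSpace VF F)] [∀ x, NormedAddCommGroup (F x)]
  [∀ x, InnerProductSpace ℝ (F x)] [FiberBundle VF F] [VectorBundle ℝ VF F]
  [IsContMDiffRiemannianBundle (𝓡 n) ∞ VF F]

/-- A smooth bundle map which is injective on the fibres over a compact set is uniformly bounded
below there. -/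
lemma exists_mul_norm_le_of_ker_eq_bot [FiniteDimensional ℝ VE]
    (A : Cₛ^∞⟮𝓡 n; VE →L[ℝ] VF, fun x ↦ E x →L[ℝ] F x⟯) {K : Set X} (hK : IsCompact K)
    (hA : ∀ x ∈ K, LinearMap.ker (A x).toLinearMap = ⊥) :
    ∃ κ : ℝ, 0 < κ ∧ ∀ x ∈ K, ∀ v : E x, κ * ‖v‖ ≤ ‖A x v‖ := by
  have : IsContinuousRiemannianBundle VE E :=
    isContinuousRiemannianBundle_of_contMDiff (n := n) inferInstance
  have : IsContinuousRiemannianBundle VF F :=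
    isContinuousRiemannianBundle_of_contMDiff (n := n) inferInstance
  refine hK.induction_on (p := fun S ↦ ∃ κ : ℝ, 0 < κ ∧ ∀ x ∈ S, ∀ v : E x, κ * ‖v‖ ≤ ‖A x v‖)
    ⟨1, one_pos, by simp⟩ (fun S T hST ⟨κ, h0, h⟩ ↦ ⟨κ, h0, fun x hx ↦ h x (hST hx)⟩) ?_ ?_
  · rintro S T ⟨κ, h0, h⟩ ⟨κ', h0', h'⟩
    refine ⟨min κ κ', lt_min h0 h0', fun x hx v ↦ ?_⟩
    rcases hx with hx | hx
    · exact (mul_le_mul_of_nonneg_right (min_le_left _ _) (norm_nonneg _)).trans (h x hx v)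
    · exact (mul_le_mul_of_nonneg_right (min_le_right _ _) (norm_nonneg _)).trans (h' x hx v)
  · intro x₀ hx₀
    -- In trivialisations `A` is a continuous family of maps between fixed spaces. It is bounded
    -- below at `x₀` by injectivity in finite dimension, and half of that bound persists nearby.
    set Φ : X → VE →L[ℝ] VF := fun x ↦
      ContinuousLinearMap.inCoordinates VE E VF F x₀ x x₀ x (A x) with hΦ
    have hcont : ContinuousAt Φ x₀ :=
      ((continuousAt_hom_bundle (f := fun x ↦ (⟨x, A x⟩ :
        TotalSpace (VE →L[ℝ] VF) fun x ↦ E x →L[ℝ] F x))).1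
          A.contMDiff.continuous.continuousAt).2
    have hbE := (trivializationAt VE E x₀).open_baseSet.mem_nhds
      (mem_baseSet_trivializationAt VE E x₀)
    have hbF := (trivializationAt VF F x₀).open_baseSet.mem_nhds
      (mem_baseSet_trivializationAt VF F x₀)
    have hinj : LinearMap.ker (Φ x₀).toLinearMap = ⊥ := by
      rw [LinearMap.ker_eq_bot]
      have hAi := LinearMap.ker_eq_bot.1 (hA x₀ hx₀)
      rw [hΦ]
      simp only
      rw [ContinuousLinearMap.inCoordinates_eq (mem_baseSet_trivializationAt VE E x₀)
        (mem_baseSet_trivializationAt VF F x₀)]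
      exact (((trivializationAt VF F x₀).continuousLinearEquivAt ℝ x₀
        (mem_baseSet_trivializationAt VF F x₀)).injective).comp
          (hAi.comp ((trivializationAt VE E x₀).continuousLinearEquivAt ℝ x₀
            (mem_baseSet_trivializationAt VE E x₀)).symm.injective)
    obtain ⟨c, hc0, hc⟩ := LinearMap.exists_antilipschitzWith _ hinj
    have hc' : ∀ v, (c : ℝ)⁻¹ * ‖v‖ ≤ ‖Φ x₀ v‖ := fun v ↦ by
      have h1 := hc.le_mul_dist v 0
      simp only [dist_zero_right, map_zero] at h1
      rw [inv_mul_le_iff₀ (by exact_mod_cast hc0)]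
      exact h1
    have hcpos : 0 < (c : ℝ)⁻¹ := inv_pos.2 (by exact_mod_cast hc0)
    obtain ⟨CE, hCE0, hCE⟩ := eventually_norm_symmL_trivializationAt_lt VE E x₀
    obtain ⟨CF, hCF0, hCF⟩ := eventually_norm_trivializationAt_lt VF F x₀
    have hnear : ∀ᶠ x in 𝓝 x₀, ‖Φ x - Φ x₀‖ < (c : ℝ)⁻¹ / 2 := by
      simpa [dist_eq_norm] using (Metric.tendsto_nhds.1 hcont) _ (half_pos hcpos)
    -- `CE` and `CF` convert the bound between model norms into one between fibre norms.
    refine ⟨_, mem_nhdsWithin_of_mem_nhds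
      (inter_mem (inter_mem hbE hCE) (inter_mem hCF hnear)),
      (c : ℝ)⁻¹ / 2 / (CE * CF), by positivity, ?_⟩
    rintro x ⟨⟨hxE, h1⟩, h2, h3⟩ v
    set v' := (trivializationAt VE E x₀).continuousLinearMapAt ℝ x v
    have hv : (trivializationAt VE E x₀).symmL ℝ x v' = v :=
      (trivializationAt VE E x₀).symmL_continuousLinearMapAt hxE v
    have e1 : ‖v‖ ≤ CE * ‖v'‖ := by
      rw [← hv]
      exact (ContinuousLinearMap.le_opNorm _ _).trans
        (mul_le_mul_of_nonneg_right (le_of_lt h1) (norm_nonneg _))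
    have e2 : ‖Φ x v'‖ ≤ CF * ‖A x v‖ := by
      have : Φ x v' = (trivializationAt VF F x₀).continuousLinearMapAt ℝ x (A x v) := by
        rw [← hv]; rfl
      rw [this]
      exact (ContinuousLinearMap.le_opNorm _ _).trans
        (mul_le_mul_of_nonneg_right (le_of_lt h2) (norm_nonneg _))
    have e3 : ‖Φ x₀ v'‖ ≤ ‖Φ x v'‖ + (c : ℝ)⁻¹ / 2 * ‖v'‖ := by
      have h4 : ‖(Φ x - Φ x₀) v'‖ ≤ (c : ℝ)⁻¹ / 2 * ‖v'‖ :=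
        (ContinuousLinearMap.le_opNorm _ _).trans
          (mul_le_mul_of_nonneg_right (le_of_lt h3) (norm_nonneg _))
      have h5 : Φ x₀ v' = Φ x v' - (Φ x - Φ x₀) v' := by simp
      rw [h5]
      exact (norm_sub_le _ _).trans (add_le_add_right h4 _)
    have e4 := hc' v'
    have e5 : (c : ℝ)⁻¹ / 2 * ‖v'‖ ≤ CF * ‖A x v‖ := by linarith
    rw [div_mul_eq_mul_div, div_le_iff₀ (by positivity)]
    calc (c : ℝ)⁻¹ / 2 * ‖v‖ ≤ (c : ℝ)⁻¹ / 2 * (CE * ‖v'‖) := by gcongr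
      _ = CE * ((c : ℝ)⁻¹ / 2 * ‖v'‖) := by ring
      _ ≤ CE * (CF * ‖A x v‖) := by gcongr
      _ = _ := by ring

/-- Over a compact manifold, finitely many smooth sections generate the smooth sections of a
vector bundle, with smooth coefficients controlled pointwise by the section. -/
lemma exists_generating_sections [IsManifold (𝓡 n) ∞ X] [T2Space X] [CompactSpace X]
    [FiniteDimensional ℝ VE] [ContMDiffVectorBundle ∞ VE E (𝓡 n)] :
    ∃ (ι : Type u) (_ : Fintype ι) (e : ι → Cₛ^∞⟮𝓡 n; VE, E⟯)
      (c : ι → Cₛ^∞⟮𝓡 n; VE, E⟯ → C^∞⟮𝓡 n, X; ℝ⟯) (B : ℝ), 0 ≤ B ∧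
      (∀ a ξ x, |c a ξ x| ≤ B * ‖ξ x‖) ∧ ∀ ξ : Cₛ^∞⟮𝓡 n; VE, E⟯,
        ξ = ∑ a, smulSection (c a ξ) (e a) := by
  have : IsContinuousRiemannianBundle VE E :=
    isContinuousRiemannianBundle_of_contMDiff (n := n) inferInstance
  choose CE hCE0 hCE using fun x₀ : X ↦ eventually_norm_trivializationAt_lt VE E x₀
  choose W hWC hW hxW using fun x₀ : X ↦ mem_nhds_iff.1 (hCE x₀)
  obtain ⟨t, ρ, hsum, hρ1, hρ⟩ := exists_finite_partition (V := EuclideanSpace ℝ (Fin n))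
    (fun x : X ↦ W x ∩ (trivializationAt VE E x).baseSet)
    (fun x ↦ (hW x).inter (trivializationAt VE E x).open_baseSet)
    (fun x ↦ ⟨hxW x, mem_baseSet_trivializationAt VE E x⟩)
  -- Local frames are made global by multiplying with `χ i`, which is one on the support of `ρ i`
  -- and so does not affect the products with `ρ i`.
  choose χ hχ1 hχ using fun i : t ↦ exists_cutoff (V := EuclideanSpace ℝ (Fin n))
    (isClosed_tsupport (ρ i)) (trivializationAt VE E (i : X)).open_baseSet
    ((hρ i).trans inter_subset_right)
  set b := Module.finBasis ℝ VE
  have he : ∀ p : t × Fin (Module.finrank ℝ VE),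
      ContMDiff (𝓡 n) ((𝓡 n).prod 𝓘(ℝ, VE)) ∞ fun x ↦
        (⟨x, ((χ p.1 : X → ℝ) • (trivializationAt VE E (p.1 : X)).localFrame b p.2) x⟩ :
          TotalSpace VE E) := fun p ↦
    ContMDiffOn.smul_section_of_tsupport (χ p.1).contMDiff.contMDiffOn
      (trivializationAt VE E (p.1 : X)).open_baseSet (hχ p.1)
      (Trivialization.contMDiffOn_localFrame_baseSet ∞ _ b p.2)
  have hc : ∀ (p : t × Fin (Module.finrank ℝ VE)) (ξ : Cₛ^∞⟮𝓡 n; VE, E⟯),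
      ContMDiff (𝓡 n) 𝓘(ℝ, ℝ) ∞ fun x ↦ ρ p.1 x *
        (trivializationAt VE E (p.1 : X)).localFrameCoeff (𝓡 n) b p.2 x (ξ x) := by
    intro p ξ
    refine contMDiff_of_tsupport fun z hz ↦ ?_
    have hz' := (hρ p.1 (tsupport_mul_subset_left hz)).2
    exact (ρ p.1).contMDiff.contMDiffAt.mul
      (contMDiffAt_localFrameCoeff b hz' ξ.contMDiff.contMDiffAt p.2)
  let N : Fin (Module.finrank ℝ VE) → ℝ := fun a ↦
    ‖LinearMap.toContinuousLinearMap (b.coord a)‖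
  have hterm : ∀ p : t × Fin (Module.finrank ℝ VE),
      0 ≤ N p.2 * CE p.1 := fun p ↦ mul_nonneg (norm_nonneg _) (hCE0 _).le
  refine ⟨t × Fin (Module.finrank ℝ VE), inferInstance, fun p ↦ ⟨_, he p⟩,
    fun p ξ ↦ ⟨_, hc p ξ⟩, ∑ p : t × Fin (Module.finrank ℝ VE), N p.2 * CE p.1,
    Finset.sum_nonneg fun p _ ↦ hterm p, fun p ξ x ↦ ?_, fun ξ ↦ ?_⟩
  · change |ρ p.1 x * _| ≤ _
    by_cases hx : x ∈ tsupport (ρ p.1)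
    · have hx' := hρ p.1 hx
      rw [abs_mul]
      refine (mul_le_of_le_one_left (abs_nonneg _) (hρ1 p.1 x)).trans ?_
      have h1 : (trivializationAt VE E (p.1 : X)).localFrameCoeff (𝓡 n) b p.2 x (ξ x) =
          LinearMap.toContinuousLinearMap (b.coord p.2)
            ((trivializationAt VE E (p.1 : X)).continuousLinearMapAt ℝ x (ξ x)) := by
        rw [Trivialization.localFrameCoeff_eq_coeff (s := fun x ↦ ξ x) _ hx'.2]
        simp [hx'.2]
      rw [h1, ← Real.norm_eq_abs]
      calc _ ≤ N p.2 * (CE p.1 * ‖ξ x‖) :=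
            (ContinuousLinearMap.le_opNorm _ _).trans (mul_le_mul_of_nonneg_left
              ((ContinuousLinearMap.le_opNorm _ _).trans (mul_le_mul_of_nonneg_right
                (le_of_lt (hWC _ hx'.1)) (norm_nonneg _))) (norm_nonneg _))
        _ = N p.2 * CE p.1 * ‖ξ x‖ := (mul_assoc _ _ _).symm
        _ ≤ _ := mul_le_mul_of_nonneg_right
            (Finset.single_le_sum (f := fun p : t × Fin (Module.finrank ℝ VE) ↦
              N p.2 * CE p.1) (fun q _ ↦ hterm q) (Finset.mem_univ p)) (norm_nonneg _)
    · rw [image_eq_zero_of_notMem_tsupport hx, zero_mul, abs_zero]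
      exact mul_nonneg (Finset.sum_nonneg fun p _ ↦ hterm p) (norm_nonneg _)
  · ext x
    rw [← ContMDiffSection.coeAddHom_apply, ← ContMDiffSection.coeAddHom_apply, map_sum,
      Finset.sum_apply, Fintype.sum_prod_type]
    have hi : ∀ i : t, ∑ a : Fin (Module.finrank ℝ VE),
        (ρ i x * (trivializationAt VE E (i : X)).localFrameCoeff (𝓡 n) b a x (ξ x)) •
          (χ i x • (trivializationAt VE E (i : X)).localFrame b a x) = ρ i x • ξ x := by
      intro i
      by_cases hx : x ∈ tsupport (ρ i)
      · rw [(hχ1 i x hx).self_of_nhds]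
        simp only [one_smul, mul_smul]
        rw [← Finset.smul_sum]
        congr 1
        exact (Trivialization.eq_sum_localFrameCoeff_smul (s := fun x ↦ ξ x) (hρ i hx).2).symm
      · simp [image_eq_zero_of_notMem_tsupport hx]
    refine Eq.trans ?_ (Finset.sum_congr rfl fun i _ ↦ (hi i).symm)
    rw [← Finset.sum_smul, hsum, one_smul]
    rfl

end Bundles

/-! ### The cross term of a concentrating pair -/

section Operators

open Set Filter Topology

variable {n : ℕ} {X : Type*} [TopologicalSpace X] [ChartedSpace (EuclideanSpace ℝ (Fin n)) X]
  {VE : Type*} [NormedAddCommGroup VE] [NormedSpace ℝ VE]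
  {E : X → Type*} [TopologicalSpace (TotalSpace VE E)] [∀ x, NormedAddCommGroup (E x)]
  [FiberBundle VE E]

lemma l2Norm_sq [RiemannianBundle (fun x : X ↦ TangentSpace (𝓡 n) x)] [MeasurableSpace X]
    (ξ : Cₛ^∞⟮𝓡 n; VE, E⟯) :
    l2Norm ξ ^ 2 = ∫ x, ‖ξ x‖ ^ 2 ∂(riemannianVolume n X) :=
  Real.sq_sqrt (integral_nonneg fun _ ↦ by positivity)

variable [∀ x, InnerProductSpace ℝ (E x)] [VectorBundle ℝ VE E]
  {VF : Type*} [NormedAddCommGroup VF] [NormedSpace ℝ VF]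
  {F : X → Type*} [TopologicalSpace (TotalSpace VF F)] [∀ x, NormedAddCommGroup (F x)]
  [∀ x, InnerProductSpace ℝ (F x)] [FiberBundle VF F] [VectorBundle ℝ VF F]

/-- The concentrating condition without adjoints: the form in which it makes the matrix `L a b` of
the cross term symmetric. -/
lemma IsConcentratingPair.inner_symm [FiniteDimensional ℝ VE] [FiniteDimensional ℝ VF]
    {σ : ∀ x : X, (TangentSpace (𝓡 n) x →L[ℝ] ℝ) →ₗ[ℝ] (E x →L[ℝ] F x)}
    {A : Cₛ^∞⟮𝓡 n; VE →L[ℝ] VF, fun x ↦ E x →L[ℝ] F x⟯} (hA : IsConcentratingPair σ A)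
    (x : X) (u : TangentSpace (𝓡 n) x →L[ℝ] ℝ) (v w : E x) :
    inner ℝ (σ x u v) (A x w) = inner ℝ (σ x u w) (A x v) := by
  have := completeSpace_fiber VE (E := E) x
  have := completeSpace_fiber VF (E := F) x
  have h : (A x).adjoint (σ x u v) = (σ x u).adjoint (A x v) :=
    congrArg (fun T : E x →L[ℝ] E x ↦ T v) (hA x u)
  rw [← ContinuousLinearMap.adjoint_inner_left, h, ContinuousLinearMap.adjoint_inner_left,
    real_inner_comm]

variable [IsContMDiffRiemannianBundle (𝓡 n) ∞ VF F]

lemma contMDiff_inner_section (ξ η : Cₛ^∞⟮𝓡 n; VF, F⟯) :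
    ContMDiff (𝓡 n) 𝓘(ℝ, ℝ) ∞ fun x ↦ inner ℝ (ξ x) (η x) :=
  ContMDiff.inner_bundle ξ.contMDiff η.contMDiff

variable [CompactSpace X] [IsManifold (𝓡 n) ∞ X]
  [RiemannianBundle (fun x : X ↦ TangentSpace (𝓡 n) x)]
  [IsContMDiffRiemannianBundle (𝓡 n) ∞ (EuclideanSpace ℝ (Fin n))
      (fun x : X ↦ TangentSpace (𝓡 n) x)]
  [MeasurableSpace X] [BorelSpace X]

lemma integrable_riemannianVolume_of_continuous {f : X → ℝ} (hf : Continuous f) :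
    Integrable f (riemannianVolume n X) :=
  hf.integrable_of_hasCompactSupport (isClosed_tsupport _).isCompact

lemma integrable_inner_section (ξ η : Cₛ^∞⟮𝓡 n; VF, F⟯) :
    Integrable (fun x ↦ inner ℝ (ξ x) (η x)) (riemannianVolume n X) :=
  integrable_riemannianVolume_of_continuous (contMDiff_inner_section ξ η).continuous

lemma integrable_norm_sq_section (ξ : Cₛ^∞⟮𝓡 n; VF, F⟯) :
    Integrable (fun x ↦ ‖ξ x‖ ^ 2) (riemannianVolume n X) := by
  simpa only [real_inner_self_eq_norm_sq] using integrable_inner_section ξ ξ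

lemma l2Norm_perturbedOp_sq (D : Cₛ^∞⟮𝓡 n; VE, E⟯ →ₗ[ℝ] Cₛ^∞⟮𝓡 n; VF, F⟯)
    (A : Cₛ^∞⟮𝓡 n; VE →L[ℝ] VF, fun x ↦ E x →L[ℝ] F x⟯) (s : ℝ) (ξ : Cₛ^∞⟮𝓡 n; VE, E⟯) :
    l2Norm (perturbedOp D A s ξ) ^ 2 = ∫ x, ‖D ξ x‖ ^ 2 ∂(riemannianVolume n X) +
      2 * s * ∫ x, inner ℝ (D ξ x) (bundleMapOp A ξ x) ∂(riemannianVolume n X) +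
      s ^ 2 * ∫ x, ‖bundleMapOp A ξ x‖ ^ 2 ∂(riemannianVolume n X) := by
  have h1 : Integrable (fun x ↦ ‖D ξ x‖ ^ 2 + 2 * s * inner ℝ (D ξ x) (bundleMapOp A ξ x))
      (riemannianVolume n X) :=
    (integrable_norm_sq_section _).add ((integrable_inner_section _ _).const_mul _)
  rw [l2Norm_sq, ← integral_const_mul, ← integral_const_mul,
    ← integral_add (integrable_norm_sq_section _) ((integrable_inner_section _ _).const_mul _),
    ← integral_add h1 ((integrable_norm_sq_section _).const_mul _)]
  refine integral_congr_ae (Eventually.of_forall fun x ↦ ?_)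
  have h : perturbedOp D A s ξ x = D ξ x + s • bundleMapOp A ξ x := rfl
  simp only [h, norm_add_sq_real, norm_smul, inner_smul_right, mul_pow, Real.norm_eq_abs, sq_abs]
  ring

variable [T2Space X] [FiniteDimensional ℝ VE] [FiniteDimensional ℝ VF]
  [ContMDiffVectorBundle ∞ VE E (𝓡 n)] [IsContMDiffRiemannianBundle (𝓡 n) ∞ VE E]

/-- For a concentrating pair the cross term `⟨D ξ, A ξ⟩` is of order zero after integration. -/
lemma exists_abs_integral_inner_le (D : Cₛ^∞⟮𝓡 n; VE, E⟯ →ₗ[ℝ] Cₛ^∞⟮𝓡 n; VF, F⟯)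
    (σ : ∀ x : X, (TangentSpace (𝓡 n) x →L[ℝ] ℝ) →ₗ[ℝ] (E x →L[ℝ] F x)) (hD : HasSymbol D σ)
    (A : Cₛ^∞⟮𝓡 n; VE →L[ℝ] VF, fun x ↦ E x →L[ℝ] F x⟯) (hA : IsConcentratingPair σ A) :
    ∃ C : ℝ, 0 ≤ C ∧ ∀ ξ : Cₛ^∞⟮𝓡 n; VE, E⟯,
      |∫ x, inner ℝ (D ξ x) (bundleMapOp A ξ x) ∂(riemannianVolume n X)| ≤
        C * ∫ x, ‖ξ x‖ ^ 2 ∂(riemannianVolume n X) := by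
  obtain ⟨ι, _, e, c, B, hB0, hB, hc⟩ := exists_generating_sections (n := n) (VE := VE) (E := E)
  let L : ι → ι → ∀ x : X, (TangentSpace (𝓡 n) x →L[ℝ] ℝ) →ₗ[ℝ] ℝ := fun a b x ↦
    { toFun u := inner ℝ (σ x u (e a x)) (A x (e b x))
      map_add' u v := by simp [inner_add_left]
      map_smul' r u := by simp [inner_smul_left] }
  have hLdef : ∀ a b x u, L a b x u = inner ℝ (σ x u (e a x)) (A x (e b x)) :=
    fun _ _ _ _ ↦ rfl
  have hLsymm : ∀ a b x u, L a b x u = L b a x u := fun a b x u ↦ hA.inner_symm x u _ _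
  have hL : ∀ a b (f : C^∞⟮𝓡 n, X; ℝ⟯),
      ContMDiff (𝓡 n) 𝓘(ℝ, ℝ) ∞ fun x ↦ L a b x (mvfderiv (𝓡 n) f x) := by
    intro a b f
    -- No smoothness of `σ` is assumed; it comes from `σ(df) e_a = D (f e_a) - f D e_a`, which is a
    -- smooth section.
    have h1 : (fun x ↦ L a b x (mvfderiv (𝓡 n) f x)) = fun x ↦
        inner ℝ (D (smulSection f (e a)) x) (bundleMapOp A (e b) x) -
          f x * inner ℝ (D (e a) x) (bundleMapOp A (e b) x) := by
      funext x
      rw [hD f (e a) x, inner_add_left, real_inner_smul_left, add_sub_cancel_right]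
      rfl
    rw [h1]
    exact (contMDiff_inner_section _ _).sub (f.contMDiff.mul (contMDiff_inner_section _ _))
  choose K hK0 hK using fun a b ↦ exists_abs_integral_derivation_le (L a b) (hL a b)
  have hm : ∀ a b, ∃ m, ∀ x, |(inner ℝ (D (e a) x) (bundleMapOp A (e b) x) : ℝ)| ≤ m := by
    intro a b
    obtain ⟨m, hm⟩ := isCompact_univ.exists_bound_of_continuousOn
      (contMDiff_inner_section (D (e a)) (bundleMapOp A (e b))).continuous.continuousOn
    exact ⟨m, fun x ↦ hm x (mem_univ x)⟩
  choose m hm using hm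
  -- `K` comes from the divergence estimate, `m` bounds `⟨D e_a, A e_b⟩`, and `B ^ 2` comes from
  -- `|f_a f_b| ≤ B²|ξ|²`.
  refine ⟨∑ a, ∑ b, (2⁻¹ * K a b + |m a b|) * B ^ 2, ?_, fun ξ ↦ ?_⟩
  · exact Finset.sum_nonneg fun a _ ↦ Finset.sum_nonneg fun b _ ↦
      mul_nonneg (add_nonneg (mul_nonneg (by norm_num) (hK0 a b)) (abs_nonneg _)) (sq_nonneg _)
  set f : ι → C^∞⟮𝓡 n, X; ℝ⟯ := fun a ↦ c a ξ
  have hff : ∀ a b x, |f a x * f b x| ≤ B ^ 2 * ‖ξ x‖ ^ 2 := by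
    intro a b x
    rw [abs_mul]
    calc _ ≤ (B * ‖ξ x‖) * (B * ‖ξ x‖) :=
          mul_le_mul (hB a ξ x) (hB b ξ x) (abs_nonneg _) (by positivity)
      _ = _ := by ring
  have hξ : ∀ x, ξ x = ∑ a, f a x • e a x := by
    intro x
    conv_lhs => rw [hc ξ]
    rw [← ContMDiffSection.coeAddHom_apply, map_sum, Finset.sum_apply]
    rfl
  have hDξ : ∀ x, D ξ x = ∑ a, (σ x (mvfderiv (𝓡 n) (f a) x) (e a x) + f a x • D (e a) x) := by
    intro x
    conv_lhs => rw [hc ξ]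
    rw [map_sum, ← ContMDiffSection.coeAddHom_apply, map_sum, Finset.sum_apply]
    exact Finset.sum_congr rfl fun a _ ↦ hD (f a) (e a) x
  have hAξ : ∀ x, bundleMapOp A ξ x = ∑ b, f b x • bundleMapOp A (e b) x := by
    intro x
    change A x (ξ x) = ∑ b, f b x • A x (e b x)
    rw [hξ x, map_sum]
    exact Finset.sum_congr rfl fun b _ ↦ map_smul _ _ _
  have hpt : ∀ x, inner ℝ (D ξ x) (bundleMapOp A ξ x) = ∑ a, ∑ b,
      (2⁻¹ * L a b x (mvfderiv (𝓡 n) (f a * f b : C^∞⟮𝓡 n, X; ℝ⟯) x) +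
        f a x * f b x * inner ℝ (D (e a) x) (bundleMapOp A (e b) x)) := by
    intro x
    have h1 : inner ℝ (D ξ x) (bundleMapOp A ξ x) = ∑ a, ∑ b,
        (f b x * L a b x (mvfderiv (𝓡 n) (f a) x) +
          f a x * f b x * inner ℝ (D (e a) x) (bundleMapOp A (e b) x)) := by
      rw [hDξ, hAξ, sum_inner]
      refine Finset.sum_congr rfl fun a _ ↦ ?_
      rw [inner_sum]
      refine Finset.sum_congr rfl fun b _ ↦ ?_
      rw [real_inner_smul_right, inner_add_left, real_inner_smul_left, mul_add, hLdef]
      change _ = f b x * inner ℝ _ (bundleMapOp A (e b) x) + _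
      ring
    have h2 : ∀ a b, L a b x (mvfderiv (𝓡 n) (f a * f b : C^∞⟮𝓡 n, X; ℝ⟯) x) =
        f a x * L a b x (mvfderiv (𝓡 n) (f b) x) + f b x * L a b x (mvfderiv (𝓡 n) (f a) x) := by
      intro a b
      rw [ContMDiffMap.coe_mul, mvfderiv_mul ((f a).contMDiff.mdifferentiableAt (by simp))
        ((f b).contMDiff.mdifferentiableAt (by simp)), map_add, map_smul, map_smul]
      rfl
    -- By symmetry of `L` both halves of the Leibniz rule have the same sum; this turns `f_b df_a`
    -- into `½ d(f_a f_b)`.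
    have h3 : ∑ a, ∑ b, f a x * L a b x (mvfderiv (𝓡 n) (f b) x) =
        ∑ a, ∑ b, f b x * L a b x (mvfderiv (𝓡 n) (f a) x) := by
      rw [Finset.sum_comm]
      exact Finset.sum_congr rfl fun a _ ↦ Finset.sum_congr rfl fun b _ ↦ by
        rw [hLsymm b a]
    have h4 : ∑ a, ∑ b, 2⁻¹ * L a b x (mvfderiv (𝓡 n) (f a * f b : C^∞⟮𝓡 n, X; ℝ⟯) x) =
        2⁻¹ * (∑ a, ∑ b, f a x * L a b x (mvfderiv (𝓡 n) (f b) x) +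
          ∑ a, ∑ b, f b x * L a b x (mvfderiv (𝓡 n) (f a) x)) := by
      simp only [h2, Finset.mul_sum, Finset.sum_add_distrib, mul_add]
    rw [h1]
    simp only [Finset.sum_add_distrib, h4, h3]
    ring
  have hi1 : ∀ a b, Integrable (fun x ↦ 2⁻¹ *
      L a b x (mvfderiv (𝓡 n) (f a * f b : C^∞⟮𝓡 n, X; ℝ⟯) x)) (riemannianVolume n X) :=
    fun a b ↦ (integrable_riemannianVolume_of_continuous
      (hL a b (f a * f b)).continuous).const_mul _
  have hi2 : ∀ a b, Integrable (fun x ↦ f a x * f b x *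
      inner ℝ (D (e a) x) (bundleMapOp A (e b) x)) (riemannianVolume n X) :=
    fun a b ↦ integrable_riemannianVolume_of_continuous
      (((f a).contMDiff.continuous.mul (f b).contMDiff.continuous).mul
        (contMDiff_inner_section _ _).continuous)
  have hi : ∀ a b, Integrable (fun x ↦
      2⁻¹ * L a b x (mvfderiv (𝓡 n) (f a * f b : C^∞⟮𝓡 n, X; ℝ⟯) x) +
        f a x * f b x * inner ℝ (D (e a) x) (bundleMapOp A (e b) x)) (riemannianVolume n X) :=
    fun a b ↦ (hi1 a b).add (hi2 a b)
  have hi3 := integrable_norm_sq_section ξ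
  rw [integral_congr_ae (Eventually.of_forall hpt), integral_finsetSum _ fun a _ ↦
    integrable_finsetSum _ fun b _ ↦ hi a b, Finset.sum_mul]
  refine (Finset.abs_sum_le_sum_abs _ _).trans (Finset.sum_le_sum fun a _ ↦ ?_)
  rw [integral_finsetSum _ fun b _ ↦ hi a b, Finset.sum_mul]
  refine (Finset.abs_sum_le_sum_abs _ _).trans (Finset.sum_le_sum fun b _ ↦ ?_)
  rw [integral_add (hi1 a b) (hi2 a b), integral_const_mul]
  have hfab : ∫ x, |f a x * f b x| ∂(riemannianVolume n X) ≤
      B ^ 2 * ∫ x, ‖ξ x‖ ^ 2 ∂(riemannianVolume n X) := by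
    rw [← integral_const_mul]
    exact integral_mono (integrable_riemannianVolume_of_continuous
      ((f a).contMDiff.continuous.mul (f b).contMDiff.continuous).abs) (hi3.const_mul _) (hff a b)
  have h1 := (hK a b (f a * f b)).trans (mul_le_mul_of_nonneg_left hfab (hK0 a b))
  have h2 : |∫ x, f a x * f b x * inner ℝ (D (e a) x) (bundleMapOp A (e b) x)
      ∂(riemannianVolume n X)| ≤
      |m a b| * (B ^ 2 * ∫ x, ‖ξ x‖ ^ 2 ∂(riemannianVolume n X)) := by
    rw [← integral_const_mul, ← integral_const_mul]
    refine abs_integral_le_integral_abs.trans (integral_mono (hi2 a b).abs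
      ((hi3.const_mul _).const_mul _) fun x ↦ ?_)
    simp only [abs_mul (f a x * f b x)]
    rw [mul_comm]
    exact mul_le_mul ((hm a b x).trans (le_abs_self _)) (hff a b x) (abs_nonneg _) (abs_nonneg _)
  refine (abs_add_le _ _).trans ?_
  rw [abs_mul, abs_of_nonneg (by norm_num : (0 : ℝ) ≤ 2⁻¹)]
  calc _ ≤ 2⁻¹ * (K a b * (B ^ 2 * ∫ x, ‖ξ x‖ ^ 2 ∂(riemannianVolume n X))) +
        |m a b| * (B ^ 2 * ∫ x, ‖ξ x‖ ^ 2 ∂(riemannianVolume n X)) :=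
        add_le_add (mul_le_mul_of_nonneg_left h1 (by norm_num)) h2
    _ = _ := by ring

end Operators

end Concentration

end

/-! ### The concentration estimate -/

theorem proposition2p4 {n : ℕ}
    {X : Type*} [EMetricSpace X] [CompactSpace X]
    [ChartedSpace (EuclideanSpace ℝ (Fin n)) X] [IsManifold (𝓡 n) ∞ X]
    [RiemannianBundle (fun x : X ↦ TangentSpace (𝓡 n) x)]
    [IsContMDiffRiemannianBundle (𝓡 n) ∞ (EuclideanSpace ℝ (Fin n))
      (fun x : X ↦ TangentSpace (𝓡 n) x)]
    [IsRiemannianManifold (𝓡 n) X]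
    [MeasurableSpace X] [BorelSpace X]
    {VE : Type*} [NormedAddCommGroup VE] [NormedSpace ℝ VE] [FiniteDimensional ℝ VE]
    {E : X → Type*} [TopologicalSpace (TotalSpace VE E)] [∀ x, NormedAddCommGroup (E x)]
    [∀ x, InnerProductSpace ℝ (E x)] [FiberBundle VE E] [VectorBundle ℝ VE E]
    [ContMDiffVectorBundle ∞ VE E (𝓡 n)] [IsContMDiffRiemannianBundle (𝓡 n) ∞ VE E]
    {VF : Type*} [NormedAddCommGroup VF] [NormedSpace ℝ VF] [FiniteDimensional ℝ VF]
    {F : X → Type*} [TopologicalSpace (TotalSpace VF F)] [∀ x, NormedAddCommGroup (F x)]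
    [∀ x, InnerProductSpace ℝ (F x)] [FiberBundle VF F] [VectorBundle ℝ VF F]
    [ContMDiffVectorBundle ∞ VF F (𝓡 n)] [IsContMDiffRiemannianBundle (𝓡 n) ∞ VF F]
    (D : Cₛ^∞⟮𝓡 n; VE, E⟯ →ₗ[ℝ] Cₛ^∞⟮𝓡 n; VF, F⟯)
    (σ : ∀ x : X, (TangentSpace (𝓡 n) x →L[ℝ] ℝ) →ₗ[ℝ] (E x →L[ℝ] F x))
    (hD : Concentration.HasSymbol D σ) (hσ : Concentration.IsElliptic σ)
    (A : Cₛ^∞⟮𝓡 n; VE →L[ℝ] VF, fun x ↦ E x →L[ℝ] F x⟯)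
    (hA : Concentration.IsConcentratingPair σ A)
    (δ : ℝ) (hδ : 0 < δ) (C : ℝ) (hC : 0 ≤ C) :
    ∃ C' : ℝ, 0 < C' ∧
      ∀ s : ℝ, s ≠ 0 → ∀ ξ : Cₛ^∞⟮𝓡 n; VE, E⟯,
        Concentration.l2Norm ξ = 1 →
        Concentration.l2Norm (Concentration.perturbedOp D A s ξ) ^ 2 ≤ C * |s| →
        ∫ x in (Metric.thickening δ (Concentration.singularSet A))ᶜ, ‖ξ x‖ ^ 2
          ∂(Concentration.riemannianVolume n X) < C' / |s| := by
  obtain ⟨C₁, hC₁, hcross⟩ := Concentration.exists_abs_integral_inner_le D σ hD A hA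
  have hKc : IsCompact (Metric.thickening δ (Concentration.singularSet A))ᶜ :=
    Metric.isOpen_thickening.isClosed_compl.isCompact
  obtain ⟨κ, hκ, hlow⟩ := Concentration.exists_mul_norm_le_of_ker_eq_bot A hKc fun x hx ↦ by
    by_contra h
    exact hx (Metric.self_subset_thickening hδ _ h)
  -- The argument gives the bound `(C + 2 * C₁) / κ ^ 2`; the extra `1` makes the inequality strict
  -- and the constant positive.
  refine ⟨(C + 2 * C₁ + 1) / κ ^ 2, by positivity, fun s hs ξ hξ hDs ↦ ?_⟩
  have hs0 : 0 < |s| := abs_pos.2 hs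
  set μ := Concentration.riemannianVolume n X
  have hξ2 : ∫ x, ‖ξ x‖ ^ 2 ∂μ = 1 := by
    rw [← Concentration.l2Norm_sq, hξ, one_pow]
  have hX := hcross ξ
  rw [hξ2, mul_one] at hX
  rw [Concentration.l2Norm_perturbedOp_sq] at hDs
  have hDnn : 0 ≤ ∫ x, ‖D ξ x‖ ^ 2 ∂μ := integral_nonneg fun _ ↦ by positivity
  set c := ∫ x, inner ℝ (D ξ x) (Concentration.bundleMapOp A ξ x) ∂μ
  set a := ∫ x, ‖Concentration.bundleMapOp A ξ x‖ ^ 2 ∂μ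
  have hsc : -(2 * s * c) ≤ 2 * (|s| * C₁) := by
    have h1 : |s * c| ≤ |s| * C₁ := by
      rw [abs_mul]
      exact mul_le_mul_of_nonneg_left hX (abs_nonneg _)
    have h2 := (abs_le.1 h1).1
    linarith
  -- The nonnegative term `∫ ‖D ξ‖²` is dropped and one factor `|s|` is cancelled.
  have ha : |s| * a ≤ C + 2 * C₁ := by
    have h1 : |s| * (|s| * a) ≤ |s| * (C + 2 * C₁) := by
      have h2 : |s| * (|s| * a) = s ^ 2 * a := by rw [← sq_abs s]; ring
      rw [h2]
      linarith
    exact le_of_mul_le_mul_left h1 hs0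
  have hint : κ ^ 2 * ∫ x in (Metric.thickening δ (Concentration.singularSet A))ᶜ, ‖ξ x‖ ^ 2 ∂μ
      ≤ a := by
    rw [← integral_const_mul]
    calc _ ≤ ∫ x in (Metric.thickening δ (Concentration.singularSet A))ᶜ,
          ‖Concentration.bundleMapOp A ξ x‖ ^ 2 ∂μ := by
          refine setIntegral_mono_on
            ((Concentration.integrable_norm_sq_section ξ).const_mul _).integrableOn
            (Concentration.integrable_norm_sq_section _).integrableOn
            hKc.isClosed.measurableSet fun x hx ↦ ?_
          rw [← mul_pow]
          exact pow_le_pow_left₀ (by positivity) (hlow x hx (ξ x)) 2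
      _ ≤ a := setIntegral_le_integral (Concentration.integrable_norm_sq_section _)
          (Filter.Eventually.of_forall fun x ↦ by positivity)
  rw [lt_div_iff₀ hs0, lt_div_iff₀ (by positivity)]
  have h3 := mul_le_mul_of_nonneg_left hint hs0.le
  linarith
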